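/- **Conventions.** For a subset $S$ of a group write $S^{\pm}=S\cup S^{-1}$. For a finite generating set $X$ of a group $G$, $|g|_X$ is the word length of $g \in G$, $d_X$ the path metric of the Cayley graph, and $w(t)$ the element of $G$ represented by the prefix of length $t$ of a word $w\in (X^\pm)^*$ (with $w(t)=w$ for $t\ge |w|$). For $H\le G$, $\mathrm{Geo}^H$ is the set of words $w\in (X^\pm)^*$ of minimal length among the words representing elements of the right coset $Hw$, and, for a fixed total ordering of $X^\pm$, $\mathrm{SL}^H$ is the set of words that are shortlex least among those representing elements of $Hw$; put $\mathrm{Geo}(G,X)=\mathrm{Geo}^{1}$, $\mathrm{SL}=\mathrm{SL}^{1}$. If $H$ is finitely generated, the pair $(G,H)$ is *strongly synchronously coset automatic with coset language* $L\subseteq (X^\pm)^*$ if $L$ is regular, contains a representative of every right coset of $H$, and there is $K$ such that whenever $v,w\in L$, $h\in H$ and $d_X(v,hw)\le 1$, then $d_X(v(t),h\,w(t))\le K$ for all $t\in\mathbb N$. $G$ is *automatic* if this holds for $(G,1)$ with some finite generating set and some language, and *shortlex automatic* over $X$ with respect to an ordering of $X^\pm$ if it holds for $(G,1)$ with the language $\mathrm{SL}$.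 For $Y\subseteq X$ and $H=\langle Y\rangle$, $\mathrm{Geo}(H,Y)$ *concatenates up to* $\mathrm{Geo}(G,X)$ if $wv\in \mathrm{Geo}(G,X)$ whenever $w\in \mathrm{Geo}(H,Y)$ and $v\in \mathrm{Geo}^H$. An isomorphism $\phi:H_1\to H_2$ of groups $H_i=\langle Y_i\rangle$ is *1-stable* if $|h|_{Y_1}\le 1$ implies $|\phi(h)|_{Y_2}\le 1$. **Graphs of groups.** Let $\Lambda=(V,E)$ be a finite connected graph with directed edges $e$ from $\iota(e)$ to $\tau(e)$, each having an opposite edge $\bar e\ne e$ with $\bar{\bar e}=e$. Let $\mathcal G$ be a graph of groups over $\Lambda$: groups $G_v$ ($v\in V$), subgroups $G_e\le G_{\tau(e)}$ and isomorphisms $\phi_e:G_e\to G_{\bar e}$ with $\phi_{\bar e}=\phi_e^{-1}$ ($e\in E$). For a maximal tree $\mathcal T$ of $\Lambda$ with set $E_{\mathcal T}$ of directed edges, $\pi_1(\mathcal G)=\pi_1(\mathcal G,\mathcal T)$ is generated by the disjoint union of the groups $G_v$ and symbols $s_e$ ($e\in E$), subject to the relations of the groups $G_v$, $s_{\bar e}=s_e^{-1}$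 for $e\in E$, $s_e=1$ for $e\in E_{\mathcal T}$, and $s_e g s_e^{-1}=\phi_e(g)$ for $e\in E$, $g\in G_e$. Let $X_v$ and $Y_e$ be finite generating sets of $G_v$ and $G_e$; $\pi_1(\mathcal G)$ is considered with the generating set $X=\bigsqcup_v X_v\cup\{s_e: e\in E\setminus E_{\mathcal T}\}$, where $s_e^{-1}$ is identified with $s_{\bar e}$ in $X^\pm$. Given coset languages $\mathcal L=\{L^e\subseteq (X_{\tau(e)}^\pm)^*\}_{e\in E}$ for the pairs $(G_{\tau(e)},G_e)$ and $e_0\in E$, the *Higgins coset language* $L(\mathcal G,\mathcal L,e_0,\mathcal T)$ is the set of words over $X^\pm$ obtained by deleting all letters $s_e$ with $e\in E_{\mathcal T}$ from the words $u_0s_{e_1}u_1\cdots s_{e_k}u_k$, $k\ge 0$, such that $e_1\cdots e_k$ is a directed path in $\Lambda$ starting at $\tau(e_0)$; $u_i\in L^{e_i}$ for $0\le i\le k$; for $1\le i<k$, if $e_{i+1}=\bar e_i$ then $u_i$ does not represent an element of $G_{e_i}$; and if $k>0$ and $e_k\in E_{\mathcal T}$ then $u_k$ does not represent an element of $G_{e_k}$.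 **Theorem 4.3.** Suppose that for each $e\in E$: 1. $Y_e\subseteq X_{\tau(e)}$; 2. $\mathrm{Geo}(G_e,Y_e)$ concatenates up to $\mathrm{Geo}(G_{\tau(e)},X_{\tau(e)})$; 3. $\phi_e:G_e\to G_{\bar e}$ is 1-stable with respect to $Y_e$ and $Y_{\bar e}$; 4. $G_{\tau(e)}$ is shortlex automatic over $X_{\tau(e)}$ with respect to an ordering (which may depend on $e$) of $X_{\tau(e)}^\pm$ in which all letters of $Y_e^\pm$ precede all letters of $X_{\tau(e)}^\pm\setminus Y_e^\pm$. Let $\mathcal L$ be the set of coset languages $\mathrm{SL}^{G_e}$ of the pairs $(G_{\tau(e)},G_e)$, defined with the orderings in (4), and let $\mathcal T$ be any maximal tree in $\Lambda$. Then for each $e_0\in E$ the pair $(\pi_1(\mathcal G),G_{e_0})$ is strongly synchronously coset automatic with coset language $L=L(\mathcal G,\mathcal L,e_0,\mathcal T)$, and $L\subseteq \mathrm{Geo}^{G_{e_0}}$. Furthermore, if $E\neq\emptyset$, the group $\pi_1(\mathcal G)$ is automatic. -/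

import Mathlib

/-! ### Words over a finite alphabet of group elements -/

/-- The symmetric alphabet `S^± = S ∪ S⁻¹` attached to a subset `S` of a group. -/
abbrev SymLetter {G : Type*} [Group G] (S : Set G) : Type _ :=
  {g : G // g ∈ S ∨ g⁻¹ ∈ S}

/-- A letter of `Y^±` is a letter of `X^±` when `Y ⊆ X`. -/
def SymLetter.incl {G : Type*} [Group G] {Y X : Set G} (h : Y ⊆ X) (a : SymLetter Y) :
    SymLetter X :=
  ⟨a.1, a.2.imp (fun ha => h ha) (fun ha => h ha)⟩

/-- The group element represented by a word, where the letter `a` represents `val a`. -/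
def wordVal {G α : Type*} [Group G] (val : α → G) (w : List α) : G :=
  (w.map val).prod

/-- The alphabet `α` is finite, closed under inversion, and generates `G`
(so it plays the role of `X^±` for a finite generating set `X` of `G`). -/
structure IsSymmGenerating {G α : Type*} [Group G] (val : α → G) : Prop where
  finite : Finite α
  symm : ∀ a, ∃ b, val b = (val a)⁻¹
  generates : ∀ g : G, ∃ w : List α, wordVal val w = g

/-- The word length of `g` is at most `n`. -/
def WordLengthLE {G α : Type*} [Group G] (val : α → G) (g : G) (n : ℕ) : Prop :=
  ∃ w : List α, w.length ≤ n ∧ wordVal val w = g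

/-- The distance of `g` and `h` in the Cayley graph (with edges joining `g` and `g * val a`)
is at most `n`. -/
def WithinDist {G α : Type*} [Group G] (val : α → G) (n : ℕ) (g h : G) : Prop :=
  WordLengthLE val (g⁻¹ * h) n

/-- `w` is a geodesic word. -/
def IsGeodesic {G α : Type*} [Group G] (val : α → G) (w : List α) : Prop :=
  ∀ w' : List α, wordVal val w' = wordVal val w → w.length ≤ w'.length

/-- The words `w` and `w'` represent the same right coset of `H`, i.e. `Hw = Hw'`. -/
def SameCoset {G α : Type*} [Group G] (val : α → G) (H : Subgroup G) (w w' : List α) : Prop :=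
  ∃ h ∈ H, wordVal val w' = h * wordVal val w

/-- `w` has minimal length among all words representing the right coset `Hw`. -/
def IsCosetGeodesic {G α : Type*} [Group G] (val : α → G) (H : Subgroup G) (w : List α) : Prop :=
  ∀ w' : List α, SameCoset val H w w' → w.length ≤ w'.length

/-- The words that are shortlex minimal (with respect to the ordering `lt` of the alphabet) among
all words representing the same right coset of `H`. -/
def cosetShortlex {G α : Type*} [Group G] (val : α → G) (lt : α → α → Prop) (H : Subgroup G) :
    Language α :=
  {w | ∀ w' : List α, SameCoset val H w w' → ¬ List.Shortlex lt w' w}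

/-- The words that are shortlex minimal among all words representing the same element. -/
def shortlexWords {G α : Type*} [Group G] (val : α → G) (lt : α → α → Prop) : Language α :=
  {w | ∀ w' : List α, wordVal val w' = wordVal val w → ¬ List.Shortlex lt w' w}

/-! ### Automatic coset systems -/

/-- `L` contains a representative of every right coset of `H`. -/
def IsCosetLanguage {G α : Type*} [Group G] (val : α → G) (H : Subgroup G) (L : Language α) :
    Prop :=
  ∀ g : G, ∃ w ∈ L, ∃ h ∈ H, wordVal val w = h * g

/-- The path from `1` labelled by `v` and the path from `h` labelled by `w` synchronously
`K`-fellow travel. -/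
def SynchFellowTravel {G α : Type*} [Group G] (val : α → G) (K : ℕ) (v : List α) (h : G)
    (w : List α) : Prop :=
  ∀ t : ℕ, WithinDist val K (wordVal val (v.take t)) (h * wordVal val (w.take t))

/-- `(G, H)` is strongly synchronously coset automatic with coset language `L`. -/
structure IsStrongSynchCosetAutomatic {G α : Type*} [Group G] (val : α → G) (H : Subgroup G)
    (L : Language α) : Prop where
  generating : IsSymmGenerating val
  fg : H.FG
  coset_language : IsCosetLanguage val H L
  regular : L.IsRegular
  fellow_travel : ∃ K : ℕ, ∀ v ∈ L, ∀ w ∈ L, ∀ h ∈ H,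
    WithinDist val 1 (wordVal val v) (h * wordVal val w) → SynchFellowTravel val K v h w

/-- `L` is the language of a (synchronous) automatic structure of `G`. -/
def IsAutomaticStructure {G α : Type*} [Group G] (val : α → G) (L : Language α) : Prop :=
  IsStrongSynchCosetAutomatic val ⊥ L

/-- `G` is automatic. -/
def IsAutomaticGroup (G : Type*) [Group G] : Prop :=
  ∃ (X : Set G) (L : Language (SymLetter X)), IsAutomaticStructure (Subtype.val) L

/-- `G` is shortlex automatic over `X` with respect to the ordering `lt` of `X^±`. -/
def IsShortlexAutomatic {G : Type*} [Group G] (X : Set G)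
    (lt : SymLetter X → SymLetter X → Prop) : Prop :=
  IsStrictTotalOrder (SymLetter X) lt ∧
    IsAutomaticStructure (Subtype.val) (shortlexWords (Subtype.val) lt)

/-- Geodesics for `H = ⟨Y⟩` over `Y` concatenate up to geodesics for `G` over `X`, where
`Y ⊆ X`. -/
def ConcatenatesUp {G : Type*} [Group G] (Y X : Set G) (h : Y ⊆ X) : Prop :=
  ∀ (w : List (SymLetter Y)) (v : List (SymLetter X)),
    IsGeodesic (Subtype.val) w → IsCosetGeodesic (Subtype.val) (Subgroup.closure Y) v →
      IsGeodesic (Subtype.val) (w.map (SymLetter.incl h) ++ v)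

/-- `(H₁, H₂, φ)` is `μ`-stable with respect to `(Y₁, Y₂)`. -/
def IsStableIso {G₁ G₂ : Type*} [Group G₁] [Group G₂] {H₁ : Subgroup G₁} {H₂ : Subgroup G₂}
    (φ : H₁ ≃* H₂) (Y₁ : Set G₁) (Y₂ : Set G₂) (μ : ℕ) : Prop :=
  ∀ h : H₁, WordLengthLE (α := SymLetter Y₁) (Subtype.val) (h : G₁) μ →
    WordLengthLE (α := SymLetter Y₂) (Subtype.val) (φ h : G₂) μ

/-! ### Graphs of groups -/

/-- Directed graphs in which every edge `e` has an oppositely oriented edge `bar e`. -/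
structure OppGraph (V E : Type*) where
  ι : E → V
  τ : E → V
  bar : E → E
  bar_bar : ∀ e, bar (bar e) = e
  bar_ne : ∀ e, bar e ≠ e
  ι_bar : ∀ e, ι (bar e) = τ e
  τ_bar : ∀ e, τ (bar e) = ι e

/-- The list of edges `p` is a directed path from `u` to `v`. -/
def OppGraph.IsPath {V E : Type*} (Λ : OppGraph V E) : V → V → List E → Prop
  | u, v, [] => u = v
  | u, v, e :: p => Λ.ι e = u ∧ Λ.IsPath (Λ.τ e) v p

/-- The graph is nonempty and any two vertices are joined by a path. -/
def OppGraph.IsConnected {V E : Type*} (Λ : OppGraph V E) : Prop :=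
  Nonempty V ∧ ∀ u v, ∃ p, Λ.IsPath u v p

/-- `T` is the set of directed edges of a maximal tree: it is closed under reversal and any two
vertices of the graph are joined by exactly one path in `T` without backtracking. -/
structure OppGraph.IsMaximalTree {V E : Type*} (Λ : OppGraph V E) (T : Set E) : Prop where
  bar_mem : ∀ e ∈ T, Λ.bar e ∈ T
  existsUnique_path : ∀ u v, ∃! p : List E,
    Λ.IsPath u v p ∧ (∀ e ∈ p, e ∈ T) ∧ p.IsChain (fun e f => f ≠ Λ.bar e)

/-- A graph of groups with vertex groups `Gv`: subgroups `Ge e` of the terminal vertex groups and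
isomorphisms `φ e : Ge e ≃* Ge (bar e)` with `φ (bar e) = (φ e)⁻¹`. The last condition is
expressed as an equality in the disjoint union of the vertex groups. -/
structure GraphOfGroups {V E : Type*} (Λ : OppGraph V E) (Gv : V → Type*)
    [∀ v, Group (Gv v)] where
  Ge : ∀ e : E, Subgroup (Gv (Λ.τ e))
  φ : ∀ e : E, Ge e ≃* Ge (Λ.bar e)
  φ_bar : ∀ (e : E) (g : Ge e),
    (⟨Λ.τ (Λ.bar (Λ.bar e)), (φ (Λ.bar e) (φ e g) : Gv (Λ.τ (Λ.bar (Λ.bar e))))⟩ : Σ v, Gv v) =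
      ⟨Λ.τ e, (g : Gv (Λ.τ e))⟩

namespace GraphOfGroups

/-- The relators of the fundamental group, on the disjoint union of the vertex groups and the
symbols `s_e`. -/
inductive Relator {V E : Type*} {Λ : OppGraph V E} {Gv : V → Type*} [∀ v, Group (Gv v)]
    (𝒢 : GraphOfGroups Λ Gv) (T : Set E) : FreeGroup ((Σ v, Gv v) ⊕ E) → Prop
  | vertex (v : V) (g h : Gv v) : Relator 𝒢 T
      (FreeGroup.of (Sum.inl ⟨v, g⟩) * FreeGroup.of (Sum.inl ⟨v, h⟩) *
        (FreeGroup.of (Sum.inl ⟨v, g * h⟩))⁻¹)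
  | opposite (e : E) : Relator 𝒢 T
      (FreeGroup.of (Sum.inr (Λ.bar e)) * FreeGroup.of (Sum.inr e))
  | tree (e : E) (he : e ∈ T) : Relator 𝒢 T (FreeGroup.of (Sum.inr e))
  | edge (e : E) (g : 𝒢.Ge e) : Relator 𝒢 T
      (FreeGroup.of (Sum.inr e) * FreeGroup.of (Sum.inl ⟨Λ.τ e, (g : Gv (Λ.τ e))⟩) *
        (FreeGroup.of (Sum.inr e))⁻¹ *
        (FreeGroup.of (Sum.inl ⟨Λ.τ (Λ.bar e), (𝒢.φ e g : Gv (Λ.τ (Λ.bar e)))⟩))⁻¹)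

/-- The fundamental group of the graph of groups at the tree `T`. -/
abbrev Pi1 {V E : Type*} {Λ : OppGraph V E} {Gv : V → Type*} [∀ v, Group (Gv v)]
    (𝒢 : GraphOfGroups Λ Gv) (T : Set E) : Type _ :=
  PresentedGroup {r | 𝒢.Relator T r}

/-- The natural map from a vertex group to the fundamental group. -/
def ofVertex {V E : Type*} {Λ : OppGraph V E} {Gv : V → Type*} [∀ v, Group (Gv v)]
    (𝒢 : GraphOfGroups Λ Gv) (T : Set E) (v : V) : Gv v →* 𝒢.Pi1 T :=
  MonoidHom.mk' (fun g => PresentedGroup.of (Sum.inl ⟨v, g⟩)) (fun g h =>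
    (PresentedGroup.mk_eq_mk_of_mul_inv_mem
      (rels := {r | 𝒢.Relator T r}) (Relator.vertex v g h)).symm)

/-- The element of the fundamental group represented by `s_e`. -/
def s {V E : Type*} {Λ : OppGraph V E} {Gv : V → Type*} [∀ v, Group (Gv v)]
    (𝒢 : GraphOfGroups Λ Gv) (T : Set E) (e : E) : 𝒢.Pi1 T :=
  PresentedGroup.of (Sum.inr e)

/-- The image of the edge group `G_e` in the fundamental group. -/
def edgeSubgroup {V E : Type*} {Λ : OppGraph V E} {Gv : V → Type*} [∀ v, Group (Gv v)]
    (𝒢 : GraphOfGroups Λ Gv) (T : Set E) (e : E) : Subgroup (𝒢.Pi1 T) :=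
  (𝒢.Ge e).map (𝒢.ofVertex T (Λ.τ e))

end GraphOfGroups

/-! ### The Higgins coset language -/

/-- The alphabet of the inflated Higgins words: the disjoint union of the `X_v^±` and all `s_e`. -/
abbrev InflatedLetter {V : Type*} (E : Type*) {Gv : V → Type*} [∀ v, Group (Gv v)]
    (X : ∀ v, Set (Gv v)) : Type _ :=
  (Σ v, SymLetter (X v)) ⊕ E

/-- The alphabet of the Higgins words: the disjoint union of the `X_v^±` and the `s_e` for the
edges `e` outside `T`. It is closed under inversion since `s_e⁻¹ = s_{bar e}`. -/
abbrev HigginsLetter {V E : Type*} {Gv : V → Type*} [∀ v, Group (Gv v)]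
    (X : ∀ v, Set (Gv v)) (T : Set E) : Type _ :=
  (Σ v, SymLetter (X v)) ⊕ {e : E // e ∉ T}

/-- The element of the fundamental group represented by a letter. -/
def higginsVal {V E : Type*} {Λ : OppGraph V E} {Gv : V → Type*} [∀ v, Group (Gv v)]
    (𝒢 : GraphOfGroups Λ Gv) (X : ∀ v, Set (Gv v)) (T : Set E) : HigginsLetter X T → 𝒢.Pi1 T
  | Sum.inl ⟨v, a⟩ => 𝒢.ofVertex T v a.1
  | Sum.inr e => 𝒢.s T e.1

open Classical in
/-- The deflation of a word, obtained by omitting all letters `s_e` with `e ∈ T`. -/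
noncomputable def deflate {V E : Type*} {Gv : V → Type*} [∀ v, Group (Gv v)]
    (X : ∀ v, Set (Gv v)) (T : Set E) (w : List (InflatedLetter E X)) :
    List (HigginsLetter X T) :=
  w.filterMap (fun a => match a with
    | Sum.inl a => some (Sum.inl a)
    | Sum.inr e => if h : e ∈ T then none else some (Sum.inr ⟨e, h⟩))

/-- A word over `X_v^±`, viewed as an inflated Higgins word. -/
def vertexWord {V : Type*} (E : Type*) {Gv : V → Type*} [∀ v, Group (Gv v)]
    (X : ∀ v, Set (Gv v)) (v : V) (u : List (SymLetter (X v))) : List (InflatedLetter E X) :=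
  u.map (fun a => Sum.inl ⟨v, a⟩)

/-- The inflated Higgins coset language: all words `u₀ s_{e₁} u₁ ⋯ s_{eₖ} uₖ` such that
`e₁ ⋯ eₖ` is a path starting at `τ(e₀)`, each `uᵢ` lies in the coset language `ℒ eᵢ`
(`0 ≤ i ≤ k`), `uᵢ` does not represent an element of `G_{eᵢ}` if `1 ≤ i < k` and
`eᵢ₊₁ = bar eᵢ`, and `uₖ` does not represent an element of `G_{eₖ}` if `k > 0` and `eₖ ∈ T`.
The list `q` consists of the pairs `(eᵢ, uᵢ)` for `1 ≤ i ≤ k`. -/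
def inflatedHigginsCosetLanguage {V E : Type*} {Λ : OppGraph V E} {Gv : V → Type*}
    [∀ v, Group (Gv v)] (𝒢 : GraphOfGroups Λ Gv) (X : ∀ v, Set (Gv v))
    (ℒ : ∀ e : E, Language (SymLetter (X (Λ.τ e)))) (e₀ : E) (T : Set E) :
    Language (InflatedLetter E X) :=
  {w | ∃ (u₀ : List (SymLetter (X (Λ.τ e₀)))) (q : List (Σ e : E, List (SymLetter (X (Λ.τ e))))),
    (∃ v, Λ.IsPath (Λ.τ e₀) v (q.map Sigma.fst)) ∧
    u₀ ∈ ℒ e₀ ∧ (∀ a ∈ q, a.2 ∈ ℒ a.1) ∧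
    q.IsChain (fun a b => b.1 = Λ.bar a.1 → wordVal (Subtype.val) a.2 ∉ 𝒢.Ge a.1) ∧
    (∀ a ∈ q.getLast?, a.1 ∈ T → wordVal (Subtype.val) a.2 ∉ 𝒢.Ge a.1) ∧
    w = vertexWord E X (Λ.τ e₀) u₀ ++
      q.flatMap (fun a => Sum.inr a.1 :: vertexWord E X (Λ.τ a.1) a.2)}

/-- The Higgins coset language: the deflations of the words of the inflated one. -/
def higginsCosetLanguage {V E : Type*} {Λ : OppGraph V E} {Gv : V → Type*}
    [∀ v, Group (Gv v)] (𝒢 : GraphOfGroups Λ Gv) (X : ∀ v, Set (Gv v))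
    (ℒ : ∀ e : E, Language (SymLetter (X (Λ.τ e)))) (e₀ : E) (T : Set E) :
    Language (HigginsLetter X T) :=
  {w | ∃ w' ∈ inflatedHigginsCosetLanguage 𝒢 X ℒ e₀ T, w = deflate X T w'}

/-!
The group `π₁(𝒢)` acts on normal forms. A normal form is a reduced sequence
`(c, u₀, e₁, u₁, …, eₖ, uₖ)` along a path from `τ(e₀)`, where the `uᵢ` are the shortlex least
representatives of right cosets of the edge groups and `c ∈ G_{e₀}`. A vertex group acts on the
right on the normal forms that end at its vertex: the residue `h` in `u g = h u'` of the last word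
is carried through the last edge by `φ`, and multiplies the preceding word, and so on down to `c`.
The symbols `s_e` lengthen or shorten the sequence. The normal forms that end at different vertices
are identified by moving along the maximal tree; this is consistent because reduced paths in the
tree are unique. So `π₁(𝒢)` acts (`HigginsSeq.permHom`), and a normal form is recovered from the
element that it represents (`HigginsSeq.eq_of_val_eq`). The Higgins coset language consists of the
deflated words of the normal forms with `c = 1`, and therefore has exactly one word for every coset.

The metric input is `IsShortlexPair.coset_step`: if `u` and `u'` are coset representatives in a
vertex group, `g` has length at most one and `u g = h u'` with `h` in the edge group, then
concatenating up gives `|h| ≤ 1`, and `h ≠ 1` forces `|u| = |u'|`. By 1-stability `φ(h)` again has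
length at most one, so this repeats from syllable to syllable, and once a residue is trivial nothing
further changes. Hence multiplication by a generator changes the length of a normal form by at most
one, which makes the words of the Higgins language coset geodesics. It also leaves the two words
in step, up to one unit, in every syllable, where they fellow travel by the automatic structure of
the vertex group (`IsShortlexGraph.close_act`).

In a vertex group, the coset representatives are the shortlex least words that do not begin with a
letter of the edge group (`IsShortlexPair.mem_cosetShortlex_iff`), so they form a regular language;
an `ε`-automaton that reads the tree edges silently then recognises the Higgins language. Finally,
the factor `c` has a unique shortlex word over the generators of `G_{e₀}`, and putting it in front
gives an automatic structure for `π₁(𝒢)` itself.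
-/

/-! ### Words and fellow travelling -/

section Words

variable {G α : Type*} [Group G] {val : α → G}

@[simp] theorem wordVal_nil : wordVal val [] = 1 := rfl

@[simp] theorem wordVal_cons (a : α) (w : List α) :
    wordVal val (a :: w) = val a * wordVal val w := by
  simp [wordVal]

@[simp] theorem wordVal_append (v w : List α) :
    wordVal val (v ++ w) = wordVal val v * wordVal val w := by
  simp [wordVal]

theorem wordVal_map {H β : Type*} [Group H] {val' : β → H} {ρ : α → β} {f : G →* H}
    (hρ : ∀ a, val' (ρ a) = f (val a)) (w : List α) :
    wordVal val' (w.map ρ) = f (wordVal val w) := by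
  induction w with
  | nil => simp
  | cons a w ih => simp [ih, hρ]

theorem WordLengthLE.one (n : ℕ) : WordLengthLE val 1 n := ⟨[], by simp, rfl⟩

theorem WordLengthLE.letter (a : α) : WordLengthLE val (val a) 1 := ⟨[a], by simp, by simp⟩

theorem WordLengthLE.mono {g : G} {m n : ℕ} (h : WordLengthLE val g m) (hmn : m ≤ n) :
    WordLengthLE val g n := by
  obtain ⟨w, hw, rfl⟩ := h
  exact ⟨w, hw.trans hmn, rfl⟩

theorem WordLengthLE.mul {g h : G} {m n : ℕ} (hg : WordLengthLE val g m)
    (hh : WordLengthLE val h n) : WordLengthLE val (g * h) (m + n) := by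
  obtain ⟨v, hv, rfl⟩ := hg
  obtain ⟨w, hw, rfl⟩ := hh
  exact ⟨v ++ w, by simp; omega, by simp⟩

theorem WordLengthLE.inv (hsymm : ∀ a, ∃ b, val b = (val a)⁻¹) {g : G} {n : ℕ}
    (hg : WordLengthLE val g n) : WordLengthLE val g⁻¹ n := by
  choose inv hinv using hsymm
  obtain ⟨w, hw, rfl⟩ := hg
  refine ⟨(w.map inv).reverse, by simpa using hw, ?_⟩
  clear hw
  induction w with
  | nil => simp
  | cons a w ih => simp [ih, hinv]

theorem WordLengthLE.map {H β : Type*} [Group H] {val' : β → H} {ρ : α → β} {f : G →* H}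
    (hρ : ∀ a, val' (ρ a) = f (val a)) {g : G} {n : ℕ} (hg : WordLengthLE val g n) :
    WordLengthLE val' (f g) n := by
  obtain ⟨w, hw, rfl⟩ := hg
  exact ⟨w.map ρ, by simpa using hw, wordVal_map hρ w⟩

theorem WordLengthLE.eq_one_or_letter {g : G} (h : WordLengthLE val g 1) :
    g = 1 ∨ ∃ a, val a = g := by
  obtain ⟨w, hw, rfl⟩ := h
  match w, hw with
  | [], _ => exact Or.inl rfl
  | [a], _ => exact Or.inr ⟨a, by simp⟩

theorem WithinDist.trans {g h k : G} {m n : ℕ} (h₁ : WithinDist val m g h)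
    (h₂ : WithinDist val n h k) : WithinDist val (m + n) g k := by
  simpa [WithinDist, mul_assoc] using WordLengthLE.mul h₁ h₂

theorem WithinDist.symm (hsymm : ∀ a, ∃ b, val b = (val a)⁻¹) {g h : G} {n : ℕ}
    (h₁ : WithinDist val n g h) : WithinDist val n h g := by
  simpa [WithinDist] using WordLengthLE.inv hsymm h₁

theorem WithinDist.mono {g h : G} {m n : ℕ} (h₁ : WithinDist val m g h) (hmn : m ≤ n) :
    WithinDist val n g h :=
  WordLengthLE.mono h₁ hmn

theorem WithinDist.refl (g : G) (n : ℕ) : WithinDist val n g g := by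
  simpa [WithinDist] using WordLengthLE.one n

theorem withinDist_mul_left_iff {c g h : G} {n : ℕ} :
    WithinDist val n (c * g) (c * h) ↔ WithinDist val n g h := by
  simp [WithinDist, mul_assoc]

theorem withinDist_take_succ (w : List α) (t : ℕ) :
    WithinDist val 1 (wordVal val (w.take t)) (wordVal val (w.take (t + 1))) := by
  rcases lt_or_ge t w.length with h | h
  · rw [List.take_succ_eq_append_getElem h, wordVal_append]
    simpa [WithinDist] using WordLengthLE.letter (val := val) w[t]
  · rw [List.take_of_length_le h, List.take_of_length_le (by omega)]
    exact WithinDist.refl _ _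

theorem withinDist_take (hsymm : ∀ a, ∃ b, val b = (val a)⁻¹) (w : List α) {s t : ℕ}
    (h₁ : s ≤ t + 1) (h₂ : t ≤ s + 1) :
    WithinDist val 1 (wordVal val (w.take s)) (wordVal val (w.take t)) := by
  obtain h | h | h : s = t ∨ t = s + 1 ∨ s = t + 1 := by omega
  · rw [h]; exact WithinDist.refl _ _
  · rw [h]; exact withinDist_take_succ w s
  · rw [h]; exact (withinDist_take_succ w t).symm hsymm

/-- The paths labelled by `p` from `c` and by `p'` from `c'` synchronously `K`-fellow travel.
Unlike `SynchFellowTravel` this treats both starting points alike. -/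
def FellowTravel (val : α → G) (K : ℕ) (c : G) (p : List α) (c' : G) (p' : List α) : Prop :=
  ∀ t : ℕ, WithinDist val K (c * wordVal val (p.take t)) (c' * wordVal val (p'.take t))

theorem synchFellowTravel_iff {K : ℕ} {v : List α} {h : G} {w : List α} :
    SynchFellowTravel val K v h w ↔ FellowTravel val K 1 v h w := by
  simp [SynchFellowTravel, FellowTravel]

theorem FellowTravel.mono {K K' : ℕ} {c c' : G} {p p' : List α}
    (h : FellowTravel val K c p c' p') (hK : K ≤ K') : FellowTravel val K' c p c' p' :=
  fun t => (h t).mono hK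

theorem FellowTravel.refl (K : ℕ) (c : G) (p : List α) : FellowTravel val K c p c p :=
  fun _ => WithinDist.refl _ _

theorem FellowTravel.symm (hsymm : ∀ a, ∃ b, val b = (val a)⁻¹) {K : ℕ} {c c' : G}
    {p p' : List α} (h : FellowTravel val K c p c' p') : FellowTravel val K c' p' c p :=
  fun t => (h t).symm hsymm

theorem FellowTravel.mul_left {K : ℕ} {c c' : G} {p p' : List α}
    (h : FellowTravel val K c p c' p') (b : G) : FellowTravel val K (b * c) p (b * c') p' :=
  fun t => by
    rw [mul_assoc, mul_assoc, withinDist_mul_left_iff]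
    exact h t

theorem FellowTravel.map {H β : Type*} [Group H] {val' : β → H} {ρ : α → β} {f : G →* H}
    (hρ : ∀ a, val' (ρ a) = f (val a)) {K : ℕ} {c c' : G} {p p' : List α}
    (h : FellowTravel val K c p c' p') :
    FellowTravel val' K (f c) (p.map ρ) (f c') (p'.map ρ) := fun t => by
  rw [← List.map_take, ← List.map_take, wordVal_map hρ, wordVal_map hρ, ← map_mul, ← map_mul,
    WithinDist, ← map_inv, ← map_mul]
  exact (h t).map hρ

/-- Concatenation of fellow travelling paths whose first parts differ in length by at most one:
the constant of the first parts does not grow. -/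
theorem FellowTravel.append (hsymm : ∀ a, ∃ b, val b = (val a)⁻¹) {K K' : ℕ} {c c' : G}
    {p p' q q' : List α} (hp : FellowTravel val K c p c' p')
    (hq : FellowTravel val K' (c * wordVal val p) q (c' * wordVal val p') q')
    (h₁ : p.length ≤ p'.length + 1) (h₂ : p'.length ≤ p.length + 1) :
    FellowTravel val (max K (K' + 1)) c (p ++ q) c' (p' ++ q') := by
  intro t
  simp only [List.take_append, wordVal_append]
  by_cases ht : t ≤ p.length ∧ t ≤ p'.length
  · rw [Nat.sub_eq_zero_of_le ht.1, Nat.sub_eq_zero_of_le ht.2]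
    simpa using (hp t).mono (le_max_left _ _)
  · rw [List.take_of_length_le (l := p) (by omega), List.take_of_length_le (l := p') (by omega),
      ← mul_assoc, ← mul_assoc]
    refine WithinDist.mono (WithinDist.trans (hq _)
      (withinDist_mul_left_iff.2 (withinDist_take hsymm q' ?_ ?_))) (le_max_right _ _) <;> omega

end Words

theorem SymLetter.symm {G : Type*} [Group G] {S : Set G} (a : SymLetter S) :
    ∃ b : SymLetter S, b.1 = a.1⁻¹ :=
  ⟨⟨a.1⁻¹, by simpa using a.2.symm⟩, rfl⟩

theorem exists_wordVal_of_mem_closure {G : Type*} [Group G] {S : Set G} {g : G}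
    (hg : g ∈ Subgroup.closure S) : ∃ w : List (SymLetter S), wordVal Subtype.val w = g := by
  rw [← Subgroup.mem_toSubmonoid, Subgroup.closure_toSubmonoid] at hg
  obtain ⟨l, hl, rfl⟩ := Submonoid.exists_list_of_mem_closure hg
  lift l to List (SymLetter S) using hl
  exact ⟨l, rfl⟩

theorem wordVal_mem_closure {G : Type*} [Group G] {S : Set G} (w : List (SymLetter S)) :
    wordVal Subtype.val w ∈ Subgroup.closure S := by
  induction w with
  | nil => simp
  | cons a w ih =>
    rw [wordVal_cons]
    refine mul_mem ?_ ih
    rcases a.2 with h | h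
    · exact Subgroup.subset_closure h
    · exact inv_mem_iff.1 (Subgroup.subset_closure h)

theorem exists_isGeodesic {G α : Type*} [Group G] {val : α → G} {g : G}
    (hg : ∃ w, wordVal val w = g) : ∃ w, wordVal val w = g ∧ IsGeodesic val w := by
  obtain ⟨w, hw, hmin⟩ := (measure (List.length (α := α))).wf.has_min
    {w | wordVal val w = g} hg
  exact ⟨w, hw, fun w' hw' => not_lt.1 (hmin w' (hw'.trans hw))⟩

/-! ### Regular languages -/

theorem Language.IsRegular.of_avoid_head {α : Type*} (P : α → Prop) :
    Language.IsRegular ({w | ∀ a ∈ w.head?, ¬ P a} : Language α) := by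
  refine Language.IsRegular.of_finite_range_leftQuotient (Set.Finite.subset
    (s := {({w | ∀ a ∈ w.head?, ¬ P a} : Language α), (∅ : Set (List α)), Set.univ})
    (by simp) ?_)
  rintro _ ⟨x, rfl⟩
  cases x with
  | nil => left; rfl
  | cons a x =>
    right
    by_cases ha : P a
    · left; ext y
      simp only [Language.leftQuotient]
      constructor
      · intro h
        exact (h a rfl ha).elim
      · intro h
        exact h.elim
    · right; ext y
      constructor
      · intro _; trivial
      · intro _ b hb
        obtain rfl : a = b := by simpa using hb
        exact ha

theorem Language.IsRegular.of_forall_mem {α : Type*} (P : α → Prop) :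
    Language.IsRegular ({w | ∀ a ∈ w, P a} : Language α) := by
  refine Language.IsRegular.of_finite_range_leftQuotient (Set.Finite.subset
    (s := {({w | ∀ a ∈ w, P a} : Language α), (∅ : Set (List α))}) (by simp) ?_)
  rintro _ ⟨x, rfl⟩
  by_cases hx : ∀ a ∈ x, P a
  · left; ext y
    constructor
    · intro h a ha
      exact h a (List.mem_append_right _ ha)
    · intro h a ha
      rcases List.mem_append.1 ha with ha | ha
      exacts [hx a ha, h a ha]
  · right; ext y
    constructor
    · intro h
      exact (hx fun a ha => h a (List.mem_append_left _ ha)).elim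
    · intro h
      exact h.elim

/-- The image of a regular language under a letter-to-letter map is regular. -/
theorem Language.IsRegular.image_map {α β : Type*} {L : Language α} (hL : L.IsRegular)
    (ρ : α → β) : Language.IsRegular ({w | ∃ v ∈ L, w = v.map ρ} : Language β) := by
  obtain ⟨σ, _, M, rfl⟩ := hL
  let N : NFA β σ := ⟨fun s b => {t | ∃ a, ρ a = b ∧ t = M.step s a}, {M.start}, M.accept⟩
  have key : ∀ w s, s ∈ N.eval w ↔ ∃ v, w = v.map ρ ∧ M.eval v = s := by
    intro w
    induction w using List.reverseRecOn with
    | nil =>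
      intro s
      simp only [NFA.eval_nil, N, Set.mem_singleton_iff]
      constructor
      · rintro rfl; exact ⟨[], rfl, rfl⟩
      · rintro ⟨v, hv, rfl⟩
        obtain rfl : v = [] := by simpa using hv.symm
        rfl
    | append_singleton w b ih =>
      intro s
      rw [NFA.eval_append_singleton, NFA.mem_stepSet]
      constructor
      · rintro ⟨t, ht, a, rfl, rfl⟩
        obtain ⟨v, rfl, rfl⟩ := (ih t).1 ht
        exact ⟨v ++ [a], by simp, by simp⟩
      · rintro ⟨v, hv, rfl⟩
        obtain ⟨v, a', rfl, hva, ha'⟩ := List.map_eq_append_iff.1 hv.symm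
        obtain ⟨a, rfl, rfl⟩ : ∃ a, a' = [a] ∧ ρ a = b := by
          simpa [List.map_eq_cons_iff] using ha'
        exact ⟨M.eval v, (ih _).2 ⟨v, hva.symm, rfl⟩, a, rfl, by simp⟩
  refine Language.isRegular_iff.2 ⟨Set σ, inferInstance, N.toDFA, ?_⟩
  rw [NFA.toDFA_correct]
  ext w
  constructor
  · rintro ⟨s, hs, h⟩
    obtain ⟨v, rfl, rfl⟩ := (key w s).1 h
    exact ⟨v, hs, rfl⟩
  · rintro ⟨v, hv, rfl⟩
    exact ⟨M.eval v, hv, (key _ _).2 ⟨v, rfl, rfl⟩⟩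

theorem εNFA.isRegular_accepts {α σ : Type*} [Finite σ] (M : εNFA α σ) :
    M.accepts.IsRegular := by
  have := Fintype.ofFinite σ
  classical
  exact Language.isRegular_iff.2
    ⟨Set σ, inferInstance, M.toNFA.toDFA, by rw [NFA.toDFA_correct, εNFA.toNFA_correct]⟩

theorem εNFA.mem_eval_of_step_none {α σ : Type*} {M : εNFA α σ} {x : List α} {s t : σ}
    (hs : s ∈ M.eval x) (ht : t ∈ M.step s none) : t ∈ M.eval x := by
  cases x using List.reverseRecOn with
  | nil => exact εNFA.εClosure.step s t ht hs
  | append_singleton x a =>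
    rw [εNFA.eval_append_singleton, εNFA.mem_stepSet_iff] at hs ⊢
    obtain ⟨r, hr, hs⟩ := hs
    exact ⟨r, hr, εNFA.εClosure.step s t ht hs⟩

theorem εNFA.mem_eval_of_step_some {α σ : Type*} {M : εNFA α σ} {x : List α} {s t : σ} {a : α}
    (hs : s ∈ M.eval x) (ht : t ∈ M.step s (some a)) : t ∈ M.eval (x ++ [a]) := by
  rw [εNFA.eval_append_singleton, εNFA.mem_stepSet_iff]
  exact ⟨s, hs, εNFA.εClosure.base t ht⟩

/-- Every relation between words and states that is compatible with the transitions contains the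
relation "`s` is reachable by reading `x`". -/
theorem εNFA.eval_induction {α σ : Type*} {M : εNFA α σ} {P : List α → σ → Prop}
    (start : ∀ s ∈ M.start, P [] s)
    (none : ∀ x s t, P x s → t ∈ M.step s none → P x t)
    (some : ∀ x s a t, P x s → t ∈ M.step s (some a) → P (x ++ [a]) t)
    {x : List α} {s : σ} (hs : s ∈ M.eval x) : P x s := by
  induction x using List.reverseRecOn generalizing s with
  | nil =>
    induction hs with
    | base s hs => exact start s hs
    | step s t ht _ ih => exact none _ s t ih ht
  | append_singleton x a ih =>
    rw [εNFA.eval_append_singleton, εNFA.mem_stepSet_iff] at hs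
    obtain ⟨r, hr, hs⟩ := hs
    induction hs with
    | base s hs => exact some x r a s (ih hr) hs
    | step s t ht _ ih => exact none _ s t ih ht

/-- The concatenation of two regular languages is regular. -/
theorem Language.IsRegular.concat {α : Type*} {L₁ L₂ : Language α} (h₁ : L₁.IsRegular)
    (h₂ : L₂.IsRegular) : (L₁ * L₂).IsRegular := by
  obtain ⟨σ₁, _, M₁, rfl⟩ := h₁
  obtain ⟨σ₂, _, M₂, rfl⟩ := h₂
  let N : εNFA α (σ₁ ⊕ σ₂) :=
    { step := fun s a => match s, a with
        | Sum.inl s, none => {t | s ∈ M₁.accept ∧ t = Sum.inr M₂.start}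
        | Sum.inl s, some a => {Sum.inl (M₁.step s a)}
        | Sum.inr _, none => ∅
        | Sum.inr s, some a => {Sum.inr (M₂.step s a)}
      start := {Sum.inl M₁.start}
      accept := Sum.inr '' M₂.accept }
  have hleft : ∀ v, Sum.inl (M₁.eval v) ∈ N.eval v := by
    intro v
    induction v using List.reverseRecOn with
    | nil => exact εNFA.εClosure.base _ rfl
    | append_singleton v a ih =>
      exact εNFA.mem_eval_of_step_some ih (by simp [N])
  have hright : ∀ v ∈ M₁.accepts, ∀ w, Sum.inr (M₂.eval w) ∈ N.eval (v ++ w) := by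
    intro v hv w
    induction w using List.reverseRecOn with
    | nil =>
      rw [List.append_nil]
      exact εNFA.mem_eval_of_step_none (hleft v) ⟨hv, rfl⟩
    | append_singleton w a ih =>
      rw [← List.append_assoc]
      exact εNFA.mem_eval_of_step_some ih (by simp [N])
  have hN : M₁.accepts * M₂.accepts = N.accepts := by
    ext x
    constructor
    · rintro ⟨v, hv, w, hw, rfl⟩
      exact ⟨_, ⟨_, hw, rfl⟩, hright v hv w⟩
    · rintro ⟨_, ⟨s, hs, rfl⟩, hx⟩
      have := εNFA.eval_induction (P := fun x s => match s with
        | Sum.inl s => M₁.eval x = s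
        | Sum.inr s => ∃ v ∈ M₁.accepts, ∃ w, v ++ w = x ∧ M₂.eval w = s) ?_ ?_ ?_ hx
      · obtain ⟨v, hv, w, rfl, rfl⟩ := this
        exact ⟨v, hv, w, hs, rfl⟩
      · rintro _ rfl; rfl
      · rintro x (s | s) t h ht
        · obtain ⟨hs, rfl⟩ := ht
          have h : M₁.eval x = s := h
          exact ⟨x, by subst h; exact hs, [], by simp, rfl⟩
        · exact ht.elim
      · rintro x (s | s) a t h ht
        · obtain rfl := ht
          have h : M₁.eval x = s := h
          simp [h]
        · obtain rfl := ht
          obtain ⟨v, hv, w, rfl, rfl⟩ := h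
          exact ⟨v, hv, w ++ [a], by simp, by simp⟩
  rw [hN]
  exact N.isRegular_accepts

/-! ### Shortlex coset representatives in a single group -/

section CosetRep

variable {G α : Type*} [Group G] {val : α → G} {lt : α → α → Prop} {H : Subgroup G}

theorem SameCoset.symm {v w : List α} (h : SameCoset val H v w) : SameCoset val H w v := by
  obtain ⟨h, hh, e⟩ := h
  exact ⟨h⁻¹, inv_mem hh, by simp [e]⟩

theorem SameCoset.trans {u v w : List α} (h₁ : SameCoset val H u v) (h₂ : SameCoset val H v w) :
    SameCoset val H u w := by
  obtain ⟨h, hh, e⟩ := h₁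
  obtain ⟨k, hk, e'⟩ := h₂
  exact ⟨k * h, mul_mem hk hh, by simp [e, e', mul_assoc]⟩

theorem isCosetGeodesic_of_mem_cosetShortlex {w : List α} (hw : w ∈ cosetShortlex val lt H) :
    IsCosetGeodesic val H w :=
  fun w' h => not_lt.1 fun hlt => hw w' h (List.Shortlex.of_length_lt hlt)

theorem isGeodesic_of_mem_shortlexWords {w : List α} (hw : w ∈ shortlexWords val lt) :
    IsGeodesic val w :=
  fun w' h => not_lt.1 fun hlt => hw w' h (List.Shortlex.of_length_lt hlt)

theorem length_eq_of_isGeodesic {v w : List α} (hv : IsGeodesic val v) (hw : IsGeodesic val w)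
    (e : wordVal val v = wordVal val w) : v.length = w.length :=
  le_antisymm (hv w e.symm) (hw v e)

theorem cosetShortlex_subset_shortlexWords {w : List α} (hw : w ∈ cosetShortlex val lt H) :
    w ∈ shortlexWords val lt :=
  fun w' h => hw w' ⟨1, one_mem _, by simp [h]⟩

theorem nil_mem_cosetShortlex : [] ∈ cosetShortlex val lt H :=
  fun _ _ => List.not_shortlex_nil_right

variable [IsStrictTotalOrder α lt]

theorem eq_of_mem_cosetShortlex {v w : List α} (hv : v ∈ cosetShortlex val lt H)
    (hw : w ∈ cosetShortlex val lt H) (h : SameCoset val H v w) : v = w :=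
  Std.Trichotomous.trichotomous (r := List.Shortlex lt) v w (hw v h.symm) (hv w h)

theorem eq_of_mem_shortlexWords {v w : List α} (hv : v ∈ shortlexWords val lt)
    (hw : w ∈ shortlexWords val lt) (h : wordVal val v = wordVal val w) : v = w :=
  Std.Trichotomous.trichotomous (r := List.Shortlex lt) v w (hw v h) (hv w h.symm)

theorem mem_shortlexWords_of_cons {a : α} {w : List α} (h : a :: w ∈ shortlexWords val lt) :
    w ∈ shortlexWords val lt :=
  fun w' e hlt => h (a :: w') (by simp [e]) (List.Shortlex.cons hlt)

variable [Finite α]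

variable (lt) in
theorem wellFounded_shortlex : WellFounded (List.Shortlex lt) :=
  List.Shortlex.wf (Finite.wellFounded_of_trans_of_irrefl lt)

variable (lt) in
theorem exists_mem_shortlexWords {g : G} (hg : ∃ w, wordVal val w = g) :
    ∃ w ∈ shortlexWords val lt, wordVal val w = g := by
  obtain ⟨w, hw, hmin⟩ := (wellFounded_shortlex lt).has_min {w | wordVal val w = g} hg
  exact ⟨w, fun w' h => hmin w' (h.trans hw), hw⟩

variable (lt H) in
theorem exists_mem_cosetShortlex {g : G} (hg : ∃ w, wordVal val w = g) :
    ∃ w ∈ cosetShortlex val lt H, g * (wordVal val w)⁻¹ ∈ H := by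
  obtain ⟨w₀, rfl⟩ := hg
  obtain ⟨w, hw, hmin⟩ := (wellFounded_shortlex lt).has_min {w | SameCoset val H w₀ w}
    ⟨w₀, 1, one_mem _, by simp⟩
  obtain ⟨h, hh, e⟩ := id hw
  exact ⟨w, fun w' h => hmin w' (SameCoset.trans hw h), by simpa [e] using hh⟩

end CosetRep

/-- The hypotheses on one edge group, as a subgroup of the group `G = ⟨X⟩` at its terminal
vertex: the subgroup is generated by `Y ⊆ X`, geodesics over `Y` concatenate up, and `G` is
shortlex automatic with respect to an ordering in which the letters of `Y^±` come first. -/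
structure IsShortlexPair {G : Type*} [Group G] (Y X : Set G)
    (lt : SymLetter X → SymLetter X → Prop) : Prop where
  subset : Y ⊆ X
  concat : ConcatenatesUp Y X subset
  automatic : IsShortlexAutomatic X lt
  first : ∀ a b : SymLetter X, (a.1 ∈ Y ∨ a.1⁻¹ ∈ Y) → ¬ (b.1 ∈ Y ∨ b.1⁻¹ ∈ Y) → lt a b

namespace IsShortlexPair

variable {G : Type*} [Group G] {Y X : Set G} {lt : SymLetter X → SymLetter X → Prop}
  (P : IsShortlexPair Y X lt)

include P

theorem wordVal_incl (w : List (SymLetter Y)) :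
    wordVal Subtype.val (w.map (SymLetter.incl P.subset)) = wordVal Subtype.val w :=
  wordVal_map (ρ := SymLetter.incl P.subset) (f := MonoidHom.id G) (fun _ => rfl) w

theorem isGeodesic_incl {w : List (SymLetter Y)} (hw : IsGeodesic Subtype.val w) :
    IsGeodesic Subtype.val (w.map (SymLetter.incl P.subset)) := by
  simpa using P.concat w [] hw (fun _ _ => Nat.zero_le _)

/-- Multiplying a coset representative `u` by an element `g` of length at most one: the factor
`h` that has to be split off from `u * g = h * u'` has length at most one over `Y`, and it is
trivial unless `u` and `u'` have the same length. Both `h` and `h⁻¹` give a geodesic by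
concatenation, and the two length inequalities force this. -/
theorem coset_step {u u' : List (SymLetter X)}
    (hu : u ∈ cosetShortlex Subtype.val lt (Subgroup.closure Y))
    (hu' : u' ∈ cosetShortlex Subtype.val lt (Subgroup.closure Y)) {g h : G}
    (hg : WordLengthLE (α := SymLetter X) Subtype.val g 1) (hh : h ∈ Subgroup.closure Y)
    (e : wordVal Subtype.val u * g = h * wordVal Subtype.val u') :
    WordLengthLE (α := SymLetter Y) Subtype.val h 1 ∧ (h ≠ 1 → u.length = u'.length) ∧
      u.length ≤ u'.length + 1 ∧ u'.length ≤ u.length + 1 := by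
  obtain ⟨w₁, hw₁, hgeo₁⟩ := exists_isGeodesic (exists_wordVal_of_mem_closure hh)
  obtain ⟨w₂, hw₂, hgeo₂⟩ := exists_isGeodesic (exists_wordVal_of_mem_closure (inv_mem hh))
  obtain ⟨x₁, hx₁, hxg₁⟩ := id hg
  obtain ⟨x₂, hx₂, hxg₂⟩ := WordLengthLE.inv SymLetter.symm hg
  have h₁ := P.concat w₁ u' hgeo₁ (isCosetGeodesic_of_mem_cosetShortlex hu') (u ++ x₁)
    (by simp [P.wordVal_incl, hw₁, hxg₁, e])
  have h₂ := P.concat w₂ u hgeo₂ (isCosetGeodesic_of_mem_cosetShortlex hu) (u' ++ x₂) (by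
    rw [wordVal_append, wordVal_append, P.wordVal_incl, hw₂, hxg₂, mul_inv_eq_iff_eq_mul,
      mul_assoc, e, inv_mul_cancel_left])
  simp only [List.length_append, List.length_map] at h₁ h₂
  obtain ⟨w₃, hw₃, e₃⟩ := WordLengthLE.inv SymLetter.symm ⟨w₂, le_rfl, hw₂⟩
  have h₃ := hgeo₁ w₃ (by rw [e₃, hw₁, inv_inv])
  have pos : ∀ w : List (SymLetter Y), w.length = 0 → wordVal Subtype.val w = 1 := by
    intro w hw
    rw [List.length_eq_zero_iff.1 hw]; rfl
  refine ⟨⟨w₁, by omega, hw₁⟩, fun hne => ?_, by omega, by omega⟩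
  have p₁ : w₁.length ≠ 0 := fun h => hne (hw₁ ▸ pos w₁ h)
  have p₂ : w₂.length ≠ 0 := fun h => hne (inv_eq_one.1 (hw₂ ▸ pos w₂ h))
  omega

/-- If a shortlex least word `a w` has the same length as a word `b z` with the same value and
`b` is a letter of `Y^±`, then so is `a`. -/
theorem first_letter {a b : SymLetter X} {w z : List (SymLetter X)}
    (hw : a :: w ∈ shortlexWords Subtype.val lt)
    (e : wordVal Subtype.val (b :: z) = wordVal Subtype.val (a :: w))
    (hlen : (b :: z).length = (a :: w).length) (hb : b.1 ∈ Y ∨ b.1⁻¹ ∈ Y) :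
    a.1 ∈ Y ∨ a.1⁻¹ ∈ Y := by
  by_contra ha
  exact hw (b :: z) e (List.Shortlex.of_lex hlen (List.Lex.rel (P.first b a hb ha)))

/-- The shortlex least word of an element of the subgroup is a word over `Y^±`. -/
theorem letters_of_mem_closure {w : List (SymLetter X)}
    (hw : w ∈ shortlexWords Subtype.val lt)
    (h : wordVal Subtype.val w ∈ Subgroup.closure Y) : ∀ a ∈ w, a.1 ∈ Y ∨ a.1⁻¹ ∈ Y := by
  have := P.automatic.1
  induction w with
  | nil => simp
  | cons a w ih =>
    obtain ⟨z, hz, hgeo⟩ := exists_isGeodesic (exists_wordVal_of_mem_closure h)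
    have hlen := length_eq_of_isGeodesic (P.isGeodesic_incl hgeo)
      (isGeodesic_of_mem_shortlexWords hw) (by rw [P.wordVal_incl, hz])
    have ha : a.1 ∈ Y ∨ a.1⁻¹ ∈ Y := by
      cases z with
      | nil => simp at hlen
      | cons b z =>
        exact P.first_letter (b := SymLetter.incl P.subset b) hw
          ((P.wordVal_incl (b :: z)).trans hz) hlen b.2
    have ha' : a.1 ∈ Subgroup.closure Y := by
      rcases ha with h | h
      · exact Subgroup.subset_closure h
      · exact inv_mem_iff.1 (Subgroup.subset_closure h)
    rw [wordVal_cons, Subgroup.mul_mem_cancel_left _ ha'] at h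
    rintro b (_ | ⟨_, hb⟩)
    · exact ha
    · exact ih (mem_shortlexWords_of_cons hw) h b hb

theorem finite : Finite (SymLetter X) := P.automatic.2.generating.finite

theorem exists_word (g : G) : ∃ w : List (SymLetter X), wordVal Subtype.val w = g :=
  P.automatic.2.generating.generates g

/-- A letter of `Y^±` in front of a shortlex coset representative gives a shortlex least word. -/
theorem cons_mem_shortlexWords {y : SymLetter Y} (hy : y.1 ≠ 1) {u : List (SymLetter X)}
    (hu : u ∈ cosetShortlex Subtype.val lt (Subgroup.closure Y)) :
    SymLetter.incl P.subset y :: u ∈ shortlexWords Subtype.val lt := by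
  have := P.automatic.1
  have := P.finite
  obtain ⟨w, hw, e⟩ := exists_mem_shortlexWords lt
    ⟨SymLetter.incl P.subset y :: u, rfl⟩ (val := Subtype.val)
  have hcg := isCosetGeodesic_of_mem_cosetShortlex hu
  have hgeo : IsGeodesic Subtype.val [y] := by
    intro w' hw'
    rcases w' with _ | ⟨a, w'⟩
    · exact (hy (by simpa using hw'.symm)).elim
    · simp
  have hlen := length_eq_of_isGeodesic (isGeodesic_of_mem_shortlexWords hw)
    (P.concat [y] u hgeo hcg) e
  cases w with
  | nil => simp at hlen
  | cons a z =>
    have ha := P.first_letter hw e.symm hlen.symm y.2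
    have hk : (y.1)⁻¹ * a.1 ∈ Subgroup.closure Y := by
      have := wordVal_mem_closure [y]
      refine mul_mem (inv_mem (by simpa using this)) ?_
      rcases ha with h | h
      · exact Subgroup.subset_closure h
      · exact inv_mem_iff.1 (Subgroup.subset_closure h)
    obtain ⟨k, hk, hkgeo⟩ := exists_isGeodesic (exists_wordVal_of_mem_closure (inv_mem hk))
    have hk' := P.concat k u hkgeo hcg z (by
      rw [wordVal_append, P.wordVal_incl, hk]
      simp only [wordVal_cons] at e
      rw [mul_inv_rev, inv_inv, mul_assoc, eq_inv_mul_iff_mul_eq, e]; rfl)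
    have hk0 : k = [] := by
      simp only [List.length_append, List.length_cons, List.length_map, List.map_cons,
        List.map_nil, List.length_nil] at hk' hlen
      exact List.length_eq_zero_iff.1 (by omega)
    have hay : a = SymLetter.incl P.subset y := by
      rw [hk0, wordVal_nil, eq_comm, inv_eq_one, inv_mul_eq_one] at hk
      exact Subtype.ext hk.symm
    subst hay
    have hz : z = u := eq_of_mem_shortlexWords (mem_shortlexWords_of_cons hw)
      (cosetShortlex_subset_shortlexWords hu) (by simpa using e)
    exact hz ▸ hw

/-- The shortlex coset representatives are the shortlex least words that do not begin with a
letter of `Y^±`. -/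
theorem mem_cosetShortlex_iff {w : List (SymLetter X)} :
    w ∈ cosetShortlex Subtype.val lt (Subgroup.closure Y) ↔
      w ∈ shortlexWords Subtype.val lt ∧ ∀ a ∈ w.head?, ¬ (a.1 ∈ Y ∨ a.1⁻¹ ∈ Y) := by
  have := P.automatic.1
  have := P.finite
  constructor
  · refine fun hw => ⟨cosetShortlex_subset_shortlexWords hw, fun a ha hY => ?_⟩
    obtain ⟨z, rfl⟩ : ∃ z, w = a :: z := by
      cases w with
      | nil => simp at ha
      | cons b z => exact ⟨z, by simpa using ha⟩
    have := isCosetGeodesic_of_mem_cosetShortlex hw z ⟨a.1⁻¹, ?_, by simp⟩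
    · simp at this
    · rcases hY with h | h
      · exact inv_mem (Subgroup.subset_closure h)
      · exact Subgroup.subset_closure h
  · rintro ⟨hw, hhead⟩
    obtain ⟨u, hu, hh⟩ := exists_mem_cosetShortlex lt (Subgroup.closure Y) ⟨w, rfl⟩
    obtain ⟨z, hz, hgeo⟩ := exists_isGeodesic (exists_wordVal_of_mem_closure hh)
    have e : wordVal Subtype.val (z.map (SymLetter.incl P.subset) ++ u) =
        wordVal Subtype.val w := by
      rw [wordVal_append, P.wordVal_incl, hz, inv_mul_cancel_right]
    cases z with
    | nil =>
      exact eq_of_mem_shortlexWords (cosetShortlex_subset_shortlexWords hu) hw e ▸ hu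
    | cons b z =>
      have hlen := length_eq_of_isGeodesic
        (P.concat _ u hgeo (isCosetGeodesic_of_mem_cosetShortlex hu))
        (isGeodesic_of_mem_shortlexWords hw) e
      cases w with
      | nil => simp at hlen
      | cons a w => exact (hhead a rfl (P.first_letter hw e hlen b.2)).elim

theorem isRegular_cosetShortlex :
    (cosetShortlex Subtype.val lt (Subgroup.closure Y)).IsRegular := by
  have h := P.automatic.2.regular.inf
    (Language.IsRegular.of_avoid_head fun a : SymLetter X => a.1 ∈ Y ∨ a.1⁻¹ ∈ Y)
  have e : cosetShortlex Subtype.val lt (Subgroup.closure Y) =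
      shortlexWords Subtype.val lt ⊓
        ({w | ∀ a ∈ w.head?, ¬ (a.1 ∈ Y ∨ a.1⁻¹ ∈ Y)} : Language (SymLetter X)) := by
    ext w; exact P.mem_cosetShortlex_iff
  rw [e]
  exact h

theorem isRegular_subgroup_words :
    Language.IsRegular ({w | w ∈ shortlexWords Subtype.val lt ∧
      ∀ a ∈ w, a.1 ∈ Y ∨ a.1⁻¹ ∈ Y} : Language (SymLetter X)) :=
  P.automatic.2.regular.inf
    (Language.IsRegular.of_forall_mem fun a : SymLetter X => a.1 ∈ Y ∨ a.1⁻¹ ∈ Y)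

theorem exists_fellowTravel_shortlexWords : ∃ K : ℕ, ∀ v ∈ shortlexWords Subtype.val lt,
    ∀ w ∈ shortlexWords Subtype.val lt,
      WithinDist (α := SymLetter X) Subtype.val 1 (wordVal Subtype.val v)
        (wordVal Subtype.val w) → FellowTravel Subtype.val K 1 v 1 w := by
  obtain ⟨K, hK⟩ := P.automatic.2.fellow_travel
  refine ⟨K, fun v hv w hw h => ?_⟩
  rw [← synchFellowTravel_iff]
  exact hK v hv w hw 1 (one_mem _) (by simpa using h)

/-- Coset representatives whose cosets are adjacent fellow travel. The splitting factor is trivial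
or a letter `y`, and in the second case `y u'` is shortlex least and thus fellow travels with `u`;
removing the initial letter costs one unit. -/
theorem exists_fellowTravel_cosetShortlex : ∃ K : ℕ,
    ∀ u ∈ cosetShortlex Subtype.val lt (Subgroup.closure Y),
    ∀ u' ∈ cosetShortlex Subtype.val lt (Subgroup.closure Y), ∀ g h : G,
      WordLengthLE (α := SymLetter X) Subtype.val g 1 → h ∈ Subgroup.closure Y →
      wordVal Subtype.val u * g = h * wordVal Subtype.val u' →
      FellowTravel Subtype.val K 1 u h u' := by
  obtain ⟨K, hK⟩ := P.exists_fellowTravel_shortlexWords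
  refine ⟨K + 1, fun u hu u' hu' g h hg hh e => ?_⟩
  have hd : WithinDist (α := SymLetter X) Subtype.val 1 (wordVal Subtype.val u)
      (h * wordVal Subtype.val u') := by
    rw [← e]
    simpa [WithinDist] using hg
  rcases eq_or_ne h 1 with rfl | hne
  · rw [one_mul] at hd
    exact (hK u (cosetShortlex_subset_shortlexWords hu) u'
      (cosetShortlex_subset_shortlexWords hu') hd).mono (Nat.le_succ K)
  · obtain h1 | ⟨y, rfl⟩ := (P.coset_step hu hu' hg hh e).1.eq_one_or_letter
    · exact (hne h1).elim
    · have hft := hK u (cosetShortlex_subset_shortlexWords hu) _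
        (P.cons_mem_shortlexWords hne hu') (by simpa [SymLetter.incl] using hd)
      intro t
      have := (hft (t + 1))
      rw [one_mul, one_mul] at this
      rw [one_mul, Nat.add_comm]
      refine (withinDist_take_succ u t).trans ?_
      simpa [SymLetter.incl] using this

end IsShortlexPair

/-! ### Normal forms for a graph of groups -/

section NormalForms

variable {V E : Type*} {Λ : OppGraph V E} {Gv : V → Type*} [∀ v, Group (Gv v)]

/-- A choice, for every edge `e`, of words `rep e g` representing the right cosets of `G_e` in
`G_{τ(e)}`, where `G_e` itself is represented by the empty word. -/
structure WordTransversal (𝒢 : GraphOfGroups Λ Gv) (X : ∀ v, Set (Gv v)) where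
  rep : ∀ e, Gv (Λ.τ e) → List (SymLetter (X (Λ.τ e)))
  residue_mem : ∀ e g, g * (wordVal Subtype.val (rep e g))⁻¹ ∈ 𝒢.Ge e
  rep_mul : ∀ e, ∀ h ∈ 𝒢.Ge e, ∀ g, rep e (h * g) = rep e g
  rep_one : ∀ e, rep e 1 = []

/-- Sequences `(c, u₀, e₁, u₁, …, eₖ, uₖ)` built from the left. They stand for the element
`c u₀ s_{e₁} u₁ ⋯ s_{eₖ} uₖ`, where `c` and `u₀` lie in the vertex group at `τ(e₀)`. Nothing is
required of the entries; see `HigginsSeq.IsNormal`. -/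
inductive HigginsSeq (Λ : OppGraph V E) (X : ∀ v, Set (Gv v)) (e₀ : E) : Type _
  | base (c : Gv (Λ.τ e₀)) (u : List (SymLetter (X (Λ.τ e₀)))) : HigginsSeq Λ X e₀
  | snoc (n : HigginsSeq Λ X e₀) (e : E) (u : List (SymLetter (X (Λ.τ e)))) : HigginsSeq Λ X e₀

variable {𝒢 : GraphOfGroups Λ Gv} {X : ∀ v, Set (Gv v)} {e₀ : E}

namespace WordTransversal

variable (R : WordTransversal 𝒢 X)

/-- The element `h` of `G_e` with `g = h * rep e g`. -/
def residue (e : E) (g : Gv (Λ.τ e)) : 𝒢.Ge e := ⟨_, R.residue_mem e g⟩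

theorem residue_mul_rep (e : E) (g : Gv (Λ.τ e)) :
    (R.residue e g : Gv (Λ.τ e)) * wordVal Subtype.val (R.rep e g) = g := by
  simp [residue]

theorem rep_wordVal_rep (e : E) (g : Gv (Λ.τ e)) :
    R.rep e (wordVal Subtype.val (R.rep e g)) = R.rep e g := by
  conv_rhs => rw [← R.residue_mul_rep e g, R.rep_mul e _ (R.residue e g).2]

theorem rep_of_mem {e : E} {g : Gv (Λ.τ e)} (hg : g ∈ 𝒢.Ge e) : R.rep e g = [] := by
  simpa [R.rep_one] using R.rep_mul e g hg 1

theorem mem_of_rep_eq_nil {e : E} {g : Gv (Λ.τ e)} (hg : R.rep e g = []) : g ∈ 𝒢.Ge e := by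
  simpa [hg] using R.residue_mem e g

theorem residue_of_rep_wordVal {e : E} {u : List (SymLetter (X (Λ.τ e)))}
    (hu : R.rep e (wordVal Subtype.val u) = u) : R.residue e (wordVal Subtype.val u) = 1 :=
  Subtype.ext (by simp [residue, hu])

theorem residue_of_mem {e : E} (g : 𝒢.Ge e) : R.residue e g = g :=
  Subtype.ext (by simp [residue, R.rep_of_mem g.2])

theorem rep_rep_mul (e : E) (g h : Gv (Λ.τ e)) :
    R.rep e (wordVal Subtype.val (R.rep e g) * h) = R.rep e (g * h) := by
  conv_rhs => rw [← R.residue_mul_rep e g, mul_assoc, R.rep_mul e _ (R.residue e g).2]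

theorem residue_mul (e : E) (g h : Gv (Λ.τ e)) :
    R.residue e (g * h) =
      R.residue e g * R.residue e (wordVal Subtype.val (R.rep e g) * h) := by
  refine Subtype.ext ?_
  rw [Subgroup.coe_mul]
  simp only [residue, R.rep_rep_mul, mul_assoc, inv_mul_cancel_left]

end WordTransversal

namespace HigginsSeq

/-- The vertex at which the sequence ends. -/
def endpt : HigginsSeq Λ X e₀ → V
  | base _ _ => Λ.τ e₀
  | snoc _ e _ => Λ.τ e

/-- The initial factor `c`. -/
def head : HigginsSeq Λ X e₀ → Gv (Λ.τ e₀)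
  | base c _ => c
  | snoc n _ _ => n.head

/-- The sequence cannot be continued by the edge `e`, because it ends with `s_{bar e}`. -/
def Backtrack : HigginsSeq Λ X e₀ → E → Prop
  | base _ _, _ => False
  | snoc _ f u, e => f = Λ.bar e ∧ u = []

/-- Normal forms: the edges form a path from `τ(e₀)`, all words are coset representatives, there
is no backtracking, and the initial factor lies in `G_{e₀}`. -/
def IsNormal (R : WordTransversal 𝒢 X) : HigginsSeq Λ X e₀ → Prop
  | base c u => c ∈ 𝒢.Ge e₀ ∧ R.rep e₀ (wordVal Subtype.val u) = u
  | snoc n e u => n.IsNormal R ∧ Λ.ι e = n.endpt ∧ R.rep e (wordVal Subtype.val u) = u ∧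
      ¬ n.Backtrack e

open Classical in
/-- Right multiplication by an element of a vertex group, given with its vertex: the residue of
the last word is carried through the last edge, and so on. If the vertex is not the one at which
the sequence ends, then nothing happens. -/
noncomputable def act (R : WordTransversal 𝒢 X) :
    HigginsSeq Λ X e₀ → (Σ v, Gv v) → HigginsSeq Λ X e₀
  | base c u, p =>
    if h : p.1 = Λ.τ e₀ then
      let x := wordVal Subtype.val u * cast (congrArg Gv h) p.2
      base (c * R.residue e₀ x) (R.rep e₀ x)
    else base c u
  | snoc n e u, p =>
    if h : p.1 = Λ.τ e then
      let x := wordVal Subtype.val u * cast (congrArg Gv h) p.2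
      snoc (n.act R ⟨Λ.τ (Λ.bar e), (𝒢.φ e (R.residue e x) : Gv (Λ.τ (Λ.bar e)))⟩) e (R.rep e x)
    else snoc n e u

/-- The sequence without its last edge and word. -/
def init : HigginsSeq Λ X e₀ → HigginsSeq Λ X e₀
  | base c u => base c u
  | snoc n _ _ => n

open Classical in
/-- Right multiplication by the symbol `s_e`. -/
noncomputable def turn (e : E) (n : HigginsSeq Λ X e₀) : HigginsSeq Λ X e₀ :=
  if n.Backtrack e then n.init else snoc n e []

variable (R : WordTransversal 𝒢 X)

theorem act_base (c : Gv (Λ.τ e₀)) (u : List (SymLetter (X (Λ.τ e₀)))) (g : Gv (Λ.τ e₀)) :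
    (base c u).act R ⟨Λ.τ e₀, g⟩ = base (c * R.residue e₀ (wordVal Subtype.val u * g))
      (R.rep e₀ (wordVal Subtype.val u * g)) := by
  simp [act]

theorem act_snoc (n : HigginsSeq Λ X e₀) (e : E) (u : List (SymLetter (X (Λ.τ e))))
    (g : Gv (Λ.τ e)) :
    (snoc n e u).act R ⟨Λ.τ e, g⟩ =
      snoc (n.act R ⟨Λ.τ (Λ.bar e), (𝒢.φ e (R.residue e (wordVal Subtype.val u * g)) :
        Gv (Λ.τ (Λ.bar e)))⟩) e (R.rep e (wordVal Subtype.val u * g)) := by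
  simp [act]

theorem act_of_ne {n : HigginsSeq Λ X e₀} {p : Σ v, Gv v} (h : p.1 ≠ n.endpt) :
    n.act R p = n := by
  cases n <;> exact dif_neg h

theorem endpt_act (n : HigginsSeq Λ X e₀) (p : Σ v, Gv v) : (n.act R p).endpt = n.endpt := by
  by_cases h : p.1 = n.endpt
  · obtain ⟨v, g⟩ := p
    cases n with
    | base c u =>
      change v = Λ.τ e₀ at h
      subst h
      rw [act_base]; rfl
    | snoc n e u =>
      change v = Λ.τ e at h
      subst h
      rw [act_snoc]; rfl
  · rw [act_of_ne R h]

theorem act_mul (n : HigginsSeq Λ X e₀) (v : V) (g h : Gv v) :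
    n.act R ⟨v, g * h⟩ = (n.act R ⟨v, g⟩).act R ⟨v, h⟩ := by
  induction n generalizing v with
  | base c u =>
    by_cases hv : v = Λ.τ e₀
    · subst hv
      rw [act_base, act_base, act_base, R.rep_rep_mul, ← mul_assoc, R.residue_mul,
        Subgroup.coe_mul, ← mul_assoc]
    · simp [act, hv]
  | snoc n e u ih =>
    by_cases hv : v = Λ.τ e
    · subst hv
      rw [act_snoc, act_snoc, act_snoc, R.rep_rep_mul, ← mul_assoc, R.residue_mul, map_mul,
        Subgroup.coe_mul, ih]
    · simp [act, hv]

variable {R}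

theorem act_one {n : HigginsSeq Λ X e₀} (hn : n.IsNormal R) (v : V) :
    n.act R ⟨v, 1⟩ = n := by
  induction n generalizing v with
  | base c u =>
    by_cases hv : v = Λ.τ e₀
    · subst hv
      rw [act_base, mul_one, R.residue_of_rep_wordVal hn.2, hn.2, Subgroup.coe_one, mul_one]
    · simp [act, hv]
  | snoc n e u ih =>
    by_cases hv : v = Λ.τ e
    · subst hv
      rw [act_snoc, mul_one, R.residue_of_rep_wordVal hn.2.2.1, hn.2.2.1, map_one,
        Subgroup.coe_one, ih hn.1]
    · simp [act, hv]

/-- An element of `G_{bar e}` does not change whether the last syllable is `s_{bar e}`. -/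
theorem backtrack_act {n : HigginsSeq Λ X e₀} (hn : n.IsNormal R) {e : E}
    (k : 𝒢.Ge (Λ.bar e)) :
    (n.act R ⟨Λ.τ (Λ.bar e), k⟩).Backtrack e ↔ n.Backtrack e := by
  cases n with
  | base c u =>
    by_cases hv : Λ.τ (Λ.bar e) = Λ.τ e₀ <;> simp [act, hv, Backtrack]
  | snoc n f u =>
    by_cases hf : f = Λ.bar e
    · subst hf
      rw [act_snoc]
      simp only [Backtrack, true_and]
      constructor
      · intro h
        have hu := (Subgroup.mul_mem_cancel_right _ k.2).1 (R.mem_of_rep_eq_nil h)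
        rw [← hn.2.2.1, R.rep_of_mem hu]
      · rintro rfl
        simpa using R.rep_of_mem k.2
    · by_cases hv : Λ.τ (Λ.bar e) = Λ.τ f <;> simp [act, hv, Backtrack, hf]

theorem isNormal_act {n : HigginsSeq Λ X e₀} (hn : n.IsNormal R) (p : Σ v, Gv v) :
    (n.act R p).IsNormal R := by
  obtain ⟨v, g⟩ := p
  induction n generalizing v with
  | base c u =>
    by_cases hv : v = Λ.τ e₀
    · subst hv
      rw [act_base]
      exact ⟨mul_mem hn.1 (Subtype.prop _), R.rep_wordVal_rep _ _⟩
    · simpa [act, hv] using hn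
  | snoc n e u ih =>
    by_cases hv : v = Λ.τ e
    · subst hv
      rw [act_snoc]
      refine ⟨ih hn.1 _ _, ?_, R.rep_wordVal_rep _ _, ?_⟩
      · rw [endpt_act]; exact hn.2.1
      · rw [backtrack_act hn.1]; exact hn.2.2.2
    · simpa [act, hv] using hn

theorem turn_of_backtrack {n : HigginsSeq Λ X e₀} {e : E} (h : n.Backtrack e) :
    turn e n = n.init := if_pos h

theorem turn_of_not_backtrack {n : HigginsSeq Λ X e₀} {e : E} (h : ¬ n.Backtrack e) :
    turn e n = snoc n e [] := if_neg h

theorem turn_snoc_bar (n : HigginsSeq Λ X e₀) (e : E) : turn e (snoc n (Λ.bar e) []) = n :=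
  turn_of_backtrack (n := snoc n (Λ.bar e) []) ⟨rfl, rfl⟩

theorem eq_snoc_of_backtrack {n : HigginsSeq Λ X e₀} {e : E} (h : n.Backtrack e) :
    ∃ m, n = snoc m (Λ.bar e) [] := by
  cases n with
  | base c u => exact h.elim
  | snoc m f u =>
    obtain ⟨rfl, rfl⟩ := h
    exact ⟨m, rfl⟩

theorem isNormal_turn {n : HigginsSeq Λ X e₀} (hn : n.IsNormal R) {e : E}
    (he : Λ.ι e = n.endpt) : (turn e n).IsNormal R ∧ (turn e n).endpt = Λ.τ e := by
  by_cases h : n.Backtrack e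
  · obtain ⟨m, rfl⟩ := eq_snoc_of_backtrack h
    rw [turn_snoc_bar]
    exact ⟨hn.1, by rw [← hn.2.1, Λ.ι_bar]⟩
  · rw [turn_of_not_backtrack h]
    exact ⟨⟨hn, he, by simp [R.rep_one], h⟩, rfl⟩

theorem turn_turn {n : HigginsSeq Λ X e₀} (hn : n.IsNormal R) {e : E} :
    turn (Λ.bar e) (turn e n) = n := by
  by_cases h : n.Backtrack e
  · obtain ⟨m, rfl⟩ := eq_snoc_of_backtrack h
    rw [turn_snoc_bar, turn_of_not_backtrack hn.2.2.2]
  · rw [turn_of_not_backtrack h, turn_of_backtrack (n := snoc n e []) ⟨(Λ.bar_bar e).symm, rfl⟩]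
    rfl

/-- The relation `s_e g = φ_e(g) s_e` for the right action on normal forms. -/
theorem act_turn {n : HigginsSeq Λ X e₀} (hn : n.IsNormal R) {e : E} (g : 𝒢.Ge e) :
    (turn e n).act R ⟨Λ.τ e, g⟩ =
      turn e (n.act R ⟨Λ.τ (Λ.bar e), (𝒢.φ e g : Gv (Λ.τ (Λ.bar e)))⟩) := by
  by_cases h : n.Backtrack e
  · obtain ⟨m, rfl⟩ := eq_snoc_of_backtrack h
    rw [turn_snoc_bar, act_snoc, wordVal_nil, one_mul, R.rep_of_mem (Subtype.prop _),
      turn_snoc_bar, R.residue_of_mem, 𝒢.φ_bar]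
  · rw [turn_of_not_backtrack h, act_snoc, wordVal_nil, one_mul, R.rep_of_mem g.2,
      R.residue_of_mem, turn_of_not_backtrack]
    rwa [backtrack_act hn]

/-- The element of the fundamental group represented by the sequence. -/
def val (𝒢 : GraphOfGroups Λ Gv) (T : Set E) : HigginsSeq Λ X e₀ → 𝒢.Pi1 T
  | base c u => 𝒢.ofVertex T _ c * 𝒢.ofVertex T _ (wordVal Subtype.val u)
  | snoc n e u => n.val 𝒢 T * 𝒢.s T e * 𝒢.ofVertex T _ (wordVal Subtype.val u)

end HigginsSeq

namespace GraphOfGroups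

variable (𝒢) (T : Set E)

theorem s_bar_mul_s (e : E) : 𝒢.s T (Λ.bar e) * 𝒢.s T e = 1 :=
  PresentedGroup.one_of_mem (rels := {r | 𝒢.Relator T r}) (Relator.opposite e)

theorem s_of_mem {e : E} (he : e ∈ T) : 𝒢.s T e = 1 :=
  PresentedGroup.one_of_mem (rels := {r | 𝒢.Relator T r}) (Relator.tree e he)

theorem s_mul_ofVertex (e : E) (g : 𝒢.Ge e) :
    𝒢.s T e * 𝒢.ofVertex T _ (g : Gv (Λ.τ e)) =
      𝒢.ofVertex T _ (𝒢.φ e g : Gv (Λ.τ (Λ.bar e))) * 𝒢.s T e :=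
  mul_inv_eq_iff_eq_mul.1 (mul_inv_eq_one.1
    (PresentedGroup.one_of_mem (rels := {r | 𝒢.Relator T r}) (Relator.edge e g)))

theorem s_bar (e : E) : 𝒢.s T (Λ.bar e) = (𝒢.s T e)⁻¹ :=
  eq_inv_of_mul_eq_one_left (𝒢.s_bar_mul_s T e)

end GraphOfGroups

namespace HigginsSeq

variable {R : WordTransversal 𝒢 X} (T : Set E)

theorem val_act {n : HigginsSeq Λ X e₀} (hn : n.IsNormal R) {v : V} (hv : n.endpt = v)
    (g : Gv v) : (n.act R ⟨v, g⟩).val 𝒢 T = n.val 𝒢 T * 𝒢.ofVertex T v g := by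
  induction n generalizing v with
  | base c u =>
    change Λ.τ e₀ = v at hv
    subst hv
    rw [act_base]
    simp only [val]
    rw [map_mul, mul_assoc, ← map_mul, R.residue_mul_rep, map_mul, mul_assoc]
  | snoc n e u ih =>
    change Λ.τ e = v at hv
    subst hv
    rw [act_snoc]
    simp only [val]
    rw [ih hn.1 (by rw [Λ.τ_bar, hn.2.1]), mul_assoc (val 𝒢 T n), ← 𝒢.s_mul_ofVertex, mul_assoc,
      mul_assoc, ← map_mul, R.residue_mul_rep, map_mul, mul_assoc, mul_assoc]

theorem val_turn (n : HigginsSeq Λ X e₀) (e : E) :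
    (turn e n).val 𝒢 T = n.val 𝒢 T * 𝒢.s T e := by
  by_cases h : n.Backtrack e
  · obtain ⟨m, rfl⟩ := eq_snoc_of_backtrack h
    rw [turn_snoc_bar]
    simp only [val]
    simp [mul_assoc, 𝒢.s_bar_mul_s]
  · rw [turn_of_not_backtrack h]
    simp [val]

theorem head_turn (n : HigginsSeq Λ X e₀) (e : E) : (turn e n).head = n.head := by
  by_cases h : n.Backtrack e
  · obtain ⟨m, rfl⟩ := eq_snoc_of_backtrack h
    rw [turn_snoc_bar]
    rfl
  · rw [turn_of_not_backtrack h]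
    rfl

/-- Right multiplication by `s_{e₁} ⋯ s_{eₖ}`. -/
noncomputable def turns (p : List E) (n : HigginsSeq Λ X e₀) : HigginsSeq Λ X e₀ :=
  p.foldl (fun n e => turn e n) n

theorem isNormal_turns {p : List E} {u v : V} (hp : Λ.IsPath u v p) {n : HigginsSeq Λ X e₀}
    (hn : n.IsNormal R) (hu : n.endpt = u) :
    (turns p n).IsNormal R ∧ (turns p n).endpt = v := by
  induction p generalizing u n with
  | nil => exact ⟨hn, hu.trans hp⟩
  | cons e p ih =>
    have h := isNormal_turn hn (hp.1.trans hu.symm)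
    exact ih hp.2 h.1 h.2

/-- The path in the opposite direction. -/
def _root_.OppGraph.rev (Λ : OppGraph V E) (p : List E) : List E := (p.map Λ.bar).reverse

theorem _root_.OppGraph.isPath_append {p q : List E} {u w : V} :
    Λ.IsPath u w (p ++ q) ↔ ∃ v, Λ.IsPath u v p ∧ Λ.IsPath v w q := by
  induction p generalizing u with
  | nil => simp [OppGraph.IsPath]
  | cons e p ih => simp [OppGraph.IsPath, ih, and_assoc]

theorem _root_.OppGraph.isPath_rev {p : List E} {u v : V} (hp : Λ.IsPath u v p) :
    Λ.IsPath v u (Λ.rev p) := by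
  induction p generalizing u with
  | nil => exact (show u = v from hp).symm
  | cons e p ih =>
    rw [OppGraph.rev, List.map_cons, List.reverse_cons, OppGraph.isPath_append]
    exact ⟨_, ih hp.2, Λ.ι_bar e, by rw [Λ.τ_bar]; exact hp.1⟩

theorem _root_.OppGraph.rev_rev (p : List E) : Λ.rev (Λ.rev p) = p := by
  simp [OppGraph.rev, List.map_reverse, Function.comp_def, Λ.bar_bar]

theorem turns_rev {p : List E} {u v : V} (hp : Λ.IsPath u v p) {n : HigginsSeq Λ X e₀}
    (hn : n.IsNormal R) (hu : n.endpt = u) : turns (Λ.rev p) (turns p n) = n := by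
  induction p generalizing u n with
  | nil => rfl
  | cons e p ih =>
    have h := isNormal_turn hn (hp.1.trans hu.symm)
    have := ih hp.2 h.1 h.2
    simp only [OppGraph.rev, turns, List.map_cons, List.reverse_cons, List.foldl_append,
      List.foldl_cons, List.foldl_nil] at this ⊢
    rw [this, turn_turn hn]

theorem val_turns_of_subset {p : List E} (hp : ∀ e ∈ p, e ∈ T) (n : HigginsSeq Λ X e₀) :
    (turns p n).val 𝒢 T = n.val 𝒢 T := by
  induction p generalizing n with
  | nil => rfl
  | cons e p ih =>
    have := ih (fun f hf => hp f (List.mem_cons_of_mem _ hf)) (turn e n)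
    rw [val_turn, 𝒢.s_of_mem T (hp e List.mem_cons_self), mul_one] at this
    exact this

theorem head_turns (p : List E) (n : HigginsSeq Λ X e₀) : (turns p n).head = n.head := by
  induction p generalizing n with
  | nil => rfl
  | cons e p ih => exact (ih (turn e n)).trans (head_turn n e)

end HigginsSeq

namespace OppGraph.IsMaximalTree

variable {T : Set E} (hT : Λ.IsMaximalTree T)

include hT

/-- The reduced path in the maximal tree from `u` to `v`. -/
noncomputable def path (u v : V) : List E := (hT.existsUnique_path u v).choose

theorem isPath_path (u v : V) : Λ.IsPath u v (hT.path u v) :=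
  (hT.existsUnique_path u v).choose_spec.1.1

theorem mem_of_mem_path {u v : V} {e : E} (he : e ∈ hT.path u v) : e ∈ T :=
  (hT.existsUnique_path u v).choose_spec.1.2.1 e he

theorem isChain_path (u v : V) : (hT.path u v).IsChain (fun e f => f ≠ Λ.bar e) :=
  (hT.existsUnique_path u v).choose_spec.1.2.2

theorem path_eq {u v : V} {p : List E} (h₁ : Λ.IsPath u v p) (h₂ : ∀ e ∈ p, e ∈ T)
    (h₃ : p.IsChain (fun e f => f ≠ Λ.bar e)) : hT.path u v = p :=
  ((hT.existsUnique_path u v).choose_spec.2 p ⟨h₁, h₂, h₃⟩).symm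

theorem path_append (u : V) {e : E} (he : e ∈ T) :
    hT.path u (Λ.τ e) = hT.path u (Λ.ι e) ++ [e] ∨
      hT.path u (Λ.ι e) = hT.path u (Λ.τ e) ++ [Λ.bar e] := by
  have hp := hT.isPath_path u (Λ.ι e)
  have hc := hT.isChain_path u (Λ.ι e)
  by_cases h : ∀ f ∈ (hT.path u (Λ.ι e)).getLast?, e ≠ Λ.bar f
  · left
    refine hT.path_eq (Λ.isPath_append.2 ⟨_, hp, rfl, rfl⟩) ?_ ?_
    · intro f hf
      rcases List.mem_append.1 hf with hf | hf
      · exact hT.mem_of_mem_path hf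
      · rw [List.mem_singleton.1 hf]; exact he
    · rw [List.isChain_append]
      refine ⟨hc, by simp, fun f hf g hg => ?_⟩
      obtain rfl : e = g := by simpa using hg
      exact h f hf
  · right
    push Not at h
    obtain ⟨f, hf, rfl⟩ := h
    rw [Option.mem_def, List.getLast?_eq_some_iff] at hf
    obtain ⟨q, hq⟩ := hf
    rw [hq] at hp hc ⊢
    rw [Λ.bar_bar]
    congr 1
    obtain ⟨w, h₁, h₂, h₃⟩ := Λ.isPath_append.1 hp
    refine (hT.path_eq ?_ ?_ ?_).symm
    · rw [Λ.τ_bar, h₂]; exact h₁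
    · intro g hg
      exact hT.mem_of_mem_path (hq ▸ List.mem_append_left _ hg)
    · exact (List.isChain_append.1 hc).1

end OppGraph.IsMaximalTree

namespace HigginsSeq

variable {R : WordTransversal 𝒢 X} {T : Set E} (hT : Λ.IsMaximalTree T)

/-- Moving a normal form along the tree so that it ends at `v`. -/
noncomputable def moveTo (v : V) (n : HigginsSeq Λ X e₀) : HigginsSeq Λ X e₀ :=
  turns (hT.path (Λ.τ e₀) v) n

/-- The inverse of `moveTo`. -/
noncomputable def moveBack (v : V) (n : HigginsSeq Λ X e₀) : HigginsSeq Λ X e₀ :=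
  turns (Λ.rev (hT.path (Λ.τ e₀) v)) n

/-- The normal forms that end at `v`. -/
abbrev NormalAt (R : WordTransversal 𝒢 X) (e₀ : E) (v : V) : Type _ :=
  {n : HigginsSeq Λ X e₀ // n.IsNormal R ∧ n.endpt = v}

theorem moveTo_mem (v : V) (n : NormalAt R e₀ (Λ.τ e₀)) :
    (moveTo hT v n.1).IsNormal R ∧ (moveTo hT v n.1).endpt = v :=
  isNormal_turns (hT.isPath_path _ v) n.2.1 n.2.2

theorem moveBack_mem {v : V} {n : HigginsSeq Λ X e₀} (hn : n.IsNormal R ∧ n.endpt = v) :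
    (moveBack hT v n).IsNormal R ∧ (moveBack hT v n).endpt = Λ.τ e₀ :=
  isNormal_turns (Λ.isPath_rev (hT.isPath_path _ v)) hn.1 hn.2

theorem moveBack_moveTo (v : V) (n : NormalAt R e₀ (Λ.τ e₀)) :
    moveBack hT v (moveTo hT v n.1) = n.1 :=
  turns_rev (hT.isPath_path _ v) n.2.1 n.2.2

theorem moveTo_moveBack {v : V} {n : HigginsSeq Λ X e₀} (hn : n.IsNormal R ∧ n.endpt = v) :
    moveTo hT v (moveBack hT v n) = n := by
  have := turns_rev (Λ.isPath_rev (hT.isPath_path (Λ.τ e₀) v)) hn.1 hn.2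
  rwa [Λ.rev_rev] at this

theorem turn_moveTo {e : E} (he : e ∈ T) (n : NormalAt R e₀ (Λ.τ e₀)) :
    turn e (moveTo hT (Λ.ι e) n.1) = moveTo hT (Λ.τ e) n.1 := by
  rcases hT.path_append (Λ.τ e₀) he with h | h
  · rw [moveTo, moveTo, h, turns, turns, List.foldl_append]; rfl
  · have := turn_turn (moveTo_mem hT (Λ.τ e) n).1 (e := Λ.bar e)
    rw [Λ.bar_bar] at this
    rw [moveTo, h, turns, List.foldl_append]
    exact this

theorem act_mem {v : V} {n : HigginsSeq Λ X e₀} (hn : n.IsNormal R ∧ n.endpt = v)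
    (p : Σ v, Gv v) : (n.act R p).IsNormal R ∧ (n.act R p).endpt = v :=
  ⟨isNormal_act hn.1 p, by rw [endpt_act, hn.2]⟩

theorem turn_mem {e : E} {n : HigginsSeq Λ X e₀} (hn : n.IsNormal R ∧ n.endpt = Λ.ι e) :
    (turn e n).IsNormal R ∧ (turn e n).endpt = Λ.τ e :=
  isNormal_turn hn.1 hn.2.symm

theorem turn_bar_mem {e : E} {n : HigginsSeq Λ X e₀} (hn : n.IsNormal R ∧ n.endpt = Λ.τ e) :
    (turn (Λ.bar e) n).IsNormal R ∧ (turn (Λ.bar e) n).endpt = Λ.ι e := by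
  have := isNormal_turn hn.1 (e := Λ.bar e) (by rw [Λ.ι_bar, hn.2])
  rwa [Λ.τ_bar] at this

/-- The permutation of the normal forms ending at `τ(e₀)` given by an element of a vertex
group. -/
noncomputable def vertexPerm (R : WordTransversal 𝒢 X) (e₀ : E) (v : V) (g : Gv v) :
    Equiv.Perm (NormalAt R e₀ (Λ.τ e₀)) where
  toFun n := ⟨moveBack hT v ((moveTo hT v n.1).act R ⟨v, g⟩),
    moveBack_mem hT (act_mem (moveTo_mem hT v n) _)⟩
  invFun n := ⟨moveBack hT v ((moveTo hT v n.1).act R ⟨v, g⁻¹⟩),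
    moveBack_mem hT (act_mem (moveTo_mem hT v n) _)⟩
  left_inv n := Subtype.ext (by
    have h := moveTo_mem hT v n
    simp only
    rw [moveTo_moveBack hT (act_mem h _), ← act_mul, mul_inv_cancel, act_one h.1,
      moveBack_moveTo])
  right_inv n := Subtype.ext (by
    have h := moveTo_mem hT v n
    simp only
    rw [moveTo_moveBack hT (act_mem h _), ← act_mul, inv_mul_cancel, act_one h.1,
      moveBack_moveTo])

/-- The permutation of the normal forms ending at `τ(e₀)` given by `s_e`. -/
noncomputable def edgePerm (R : WordTransversal 𝒢 X) (e₀ e : E) :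
    Equiv.Perm (NormalAt R e₀ (Λ.τ e₀)) where
  toFun n := ⟨moveBack hT (Λ.τ e) (turn e (moveTo hT (Λ.ι e) n.1)),
    moveBack_mem hT (turn_mem (moveTo_mem hT _ n))⟩
  invFun n := ⟨moveBack hT (Λ.ι e) (turn (Λ.bar e) (moveTo hT (Λ.τ e) n.1)),
    moveBack_mem hT (turn_bar_mem (moveTo_mem hT _ n))⟩
  left_inv n := Subtype.ext (by
    have h := moveTo_mem hT (Λ.ι e) n
    simp only
    rw [moveTo_moveBack hT (turn_mem h), turn_turn h.1, moveBack_moveTo])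
  right_inv n := Subtype.ext (by
    have h := moveTo_mem hT (Λ.τ e) n
    have h' := turn_turn h.1 (e := Λ.bar e)
    rw [Λ.bar_bar] at h'
    simp only
    rw [moveTo_moveBack hT (turn_bar_mem h), h', moveBack_moveTo])

/-- The images of the generators in the (opposite) permutation group. -/
noncomputable def genPerm (R : WordTransversal 𝒢 X) (e₀ : E) :
    (Σ v, Gv v) ⊕ E → (Equiv.Perm (NormalAt R e₀ (Λ.τ e₀)))ᵐᵒᵖ
  | Sum.inl p => MulOpposite.op (vertexPerm hT R e₀ p.1 p.2)
  | Sum.inr e => MulOpposite.op (edgePerm hT R e₀ e)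

theorem lift_genPerm_relator (r : FreeGroup ((Σ v, Gv v) ⊕ E)) (hr : 𝒢.Relator T r) :
    FreeGroup.lift (genPerm hT R e₀) r = 1 := by
  cases hr with
  | vertex v g h =>
    simp only [map_mul, map_inv, FreeGroup.lift_apply_of, mul_inv_eq_one, genPerm,
      ← MulOpposite.op_mul]
    congr 1
    ext n : 2
    simp only [Equiv.Perm.mul_apply]
    simp only [vertexPerm, Equiv.coe_fn_mk]
    rw [moveTo_moveBack hT (act_mem (moveTo_mem hT v n) _), ← act_mul]
  | opposite e =>
    simp only [map_mul, FreeGroup.lift_apply_of, genPerm, ← MulOpposite.op_mul]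
    rw [MulOpposite.op_eq_one_iff]
    ext n : 2
    simp only [Equiv.Perm.mul_apply, Equiv.Perm.one_apply]
    simp only [edgePerm, Equiv.coe_fn_mk]
    have h := moveTo_mem hT (Λ.τ e) n
    have h' := turn_turn h.1 (e := Λ.bar e)
    rw [Λ.bar_bar] at h'
    rw [Λ.τ_bar, Λ.ι_bar, moveTo_moveBack hT (turn_bar_mem h), h', moveBack_moveTo]
  | tree e he =>
    simp only [FreeGroup.lift_apply_of, genPerm]
    rw [MulOpposite.op_eq_one_iff]
    ext n : 2
    simp only [Equiv.Perm.one_apply]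
    simp only [edgePerm, Equiv.coe_fn_mk]
    rw [turn_moveTo hT he, moveBack_moveTo]
  | edge e g =>
    simp only [map_mul, map_inv, FreeGroup.lift_apply_of, mul_inv_eq_iff_eq_mul, genPerm,
      one_mul, ← MulOpposite.op_mul]
    congr 1
    ext n : 2
    simp only [Equiv.Perm.mul_apply]
    simp only [vertexPerm, edgePerm, Equiv.coe_fn_mk]
    have hv : Λ.τ (Λ.bar e) = Λ.ι e := Λ.τ_bar e
    have h₁ : moveTo hT (Λ.τ (Λ.bar e)) n.1 = moveTo hT (Λ.ι e) n.1 := by rw [hv]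
    have h₂ : ∀ m : HigginsSeq Λ X e₀,
        moveBack hT (Λ.τ (Λ.bar e)) m = moveBack hT (Λ.ι e) m := by
      intro m; rw [hv]
    have h := moveTo_mem hT (Λ.ι e) n
    rw [moveTo_moveBack hT (turn_mem h), h₁, h₂, moveTo_moveBack hT (act_mem h _), act_turn h.1]

/-- The right action of the fundamental group on the normal forms ending at `τ(e₀)`. -/
noncomputable def permHom (R : WordTransversal 𝒢 X) (e₀ : E) :
    𝒢.Pi1 T →* (Equiv.Perm (NormalAt R e₀ (Λ.τ e₀)))ᵐᵒᵖ :=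
  PresentedGroup.toGroup (f := genPerm hT R e₀) (lift_genPerm_relator hT)

theorem permHom_ofVertex (v : V) (g : Gv v) :
    permHom hT R e₀ (𝒢.ofVertex T v g) = MulOpposite.op (vertexPerm hT R e₀ v g) :=
  PresentedGroup.toGroup.of (f := genPerm hT R e₀) (lift_genPerm_relator hT)

theorem permHom_s (e : E) :
    permHom hT R e₀ (𝒢.s T e) = MulOpposite.op (edgePerm hT R e₀ e) :=
  PresentedGroup.toGroup.of (f := genPerm hT R e₀) (lift_genPerm_relator hT)

/-- The normal form `(1, ε)`. -/
def basePoint (R : WordTransversal 𝒢 X) (e₀ : E) : NormalAt R e₀ (Λ.τ e₀) :=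
  ⟨base 1 [], ⟨one_mem _, by simp [R.rep_one]⟩, rfl⟩

/-- A normal form is recovered, up to moving it along the tree, from the element that it
represents. -/
theorem moveTo_permHom {n : HigginsSeq Λ X e₀} (hn : n.IsNormal R) :
    moveTo hT n.endpt ((permHom hT R e₀ (n.val 𝒢 T)).unop (basePoint R e₀)).1 = n := by
  have hvert : ∀ (v : V) (g : Gv v) (x : 𝒢.Pi1 T),
      moveTo hT v ((permHom hT R e₀ (x * 𝒢.ofVertex T v g)).unop (basePoint R e₀)).1 =
        (moveTo hT v ((permHom hT R e₀ x).unop (basePoint R e₀)).1).act R ⟨v, g⟩ := by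
    intro v g x
    rw [map_mul, permHom_ofVertex, MulOpposite.unop_mul, MulOpposite.unop_op,
      Equiv.Perm.mul_apply]
    exact moveTo_moveBack hT (act_mem (moveTo_mem hT v _) _)
  induction n with
  | base c u =>
    have hpath : hT.path (Λ.τ e₀) (Λ.τ e₀) = [] := hT.path_eq rfl (by simp) (by simp)
    have h1 : moveTo hT (Λ.τ e₀) ((permHom hT R e₀ 1).unop (basePoint R e₀)).1 =
        base 1 [] := by
      rw [map_one, moveTo, hpath]; rfl
    change moveTo hT (Λ.τ e₀) _ = _
    simp only [val]
    rw [hvert, ← one_mul (𝒢.ofVertex T _ c), hvert, h1, act_base]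
    simp only [wordVal_nil, one_mul]
    have := R.residue_of_mem ⟨c, hn.1⟩
    simp only at this
    rw [R.rep_of_mem hn.1, this, act_base]
    simp only [wordVal_nil, one_mul]
    rw [R.residue_of_rep_wordVal hn.2, hn.2, Subgroup.coe_one, mul_one]
  | snoc n e u ih =>
    change moveTo hT (Λ.τ e) _ = _
    simp only [val]
    have h2 : moveTo hT (Λ.τ e) ((permHom hT R e₀ (n.val 𝒢 T * 𝒢.s T e)).unop
        (basePoint R e₀)).1 = snoc n e [] := by
      rw [map_mul, permHom_s, MulOpposite.unop_mul, MulOpposite.unop_op, Equiv.Perm.mul_apply]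
      refine (moveTo_moveBack hT (turn_mem (moveTo_mem hT _ _))).trans ?_
      rw [hn.2.1, ih hn.1, turn_of_not_backtrack hn.2.2.2]
    rw [hvert, h2, act_snoc, wordVal_nil, one_mul, R.residue_of_rep_wordVal hn.2.2.1,
      hn.2.2.1, map_one, Subgroup.coe_one, act_one hn.1]

/-- The normal form theorem: normal forms with the same end that represent the same element are
equal. -/
theorem eq_of_val_eq {n m : HigginsSeq Λ X e₀} (hn : n.IsNormal R) (hm : m.IsNormal R)
    (hend : n.endpt = m.endpt) (h : n.val 𝒢 T = m.val 𝒢 T) (hT : Λ.IsMaximalTree T) : n = m := by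
  rw [← moveTo_permHom hT hn, ← moveTo_permHom hT hm, h, hend]

end HigginsSeq

end NormalForms

/-! ### Words of normal forms and fellow travelling -/

section Geometry

variable {V E : Type*} {Λ : OppGraph V E} {Gv : V → Type*} [∀ v, Group (Gv v)]
  {𝒢 : GraphOfGroups Λ Gv} {X : ∀ v, Set (Gv v)} {e₀ : E} {T : Set E}

namespace HigginsSeq

/-- The letters of the Higgins alphabet that come from a vertex group. -/
def vertexLetter (X : ∀ v, Set (Gv v)) (T : Set E) (v : V) (a : SymLetter (X v)) :
    HigginsLetter X T := Sum.inl ⟨v, a⟩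

open Classical in
/-- The one-letter word `s_e`, or the empty word if `e` lies in the tree. -/
noncomputable def edgeWord (X : ∀ v, Set (Gv v)) (T : Set E) (e : E) :
    List (HigginsLetter X T) :=
  if h : e ∈ T then [] else [Sum.inr ⟨e, h⟩]

/-- The deflated word `u₀ s_{e₁} u₁ ⋯ s_{eₖ} uₖ`, without the initial factor. -/
noncomputable def word (T : Set E) : HigginsSeq Λ X e₀ → List (HigginsLetter X T)
  | base _ u => u.map (vertexLetter X T _)
  | snoc n e u => n.word T ++ (edgeWord X T e ++ u.map (vertexLetter X T _))

/-- Replacing the initial factor. -/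
def setHead (d : Gv (Λ.τ e₀)) : HigginsSeq Λ X e₀ → HigginsSeq Λ X e₀
  | base _ u => base d u
  | snoc n e u => snoc (n.setHead d) e u

variable (𝒢) in
theorem higginsVal_vertexLetter (v : V) (a : SymLetter (X v)) :
    higginsVal 𝒢 X T (vertexLetter X T v a) = 𝒢.ofVertex T v a.1 := rfl

variable (𝒢) in
theorem wordVal_vertex (v : V) (u : List (SymLetter (X v))) :
    wordVal (higginsVal 𝒢 X T) (u.map (vertexLetter X T v)) =
      𝒢.ofVertex T v (wordVal Subtype.val u) :=
  wordVal_map (higginsVal_vertexLetter 𝒢 v) u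

variable (𝒢) in
theorem wordVal_edgeWord (e : E) :
    wordVal (higginsVal 𝒢 X T) (edgeWord X T e) = 𝒢.s T e := by
  by_cases h : e ∈ T
  · simp [edgeWord, h, 𝒢.s_of_mem T h]
  · simp [edgeWord, h, higginsVal]

theorem edgeWord_of_mem {e : E} (h : e ∈ T) : edgeWord X T e = [] := dif_pos h

theorem val_eq (n : HigginsSeq Λ X e₀) :
    n.val 𝒢 T = 𝒢.ofVertex T _ n.head * wordVal (higginsVal 𝒢 X T) (n.word T) := by
  induction n with
  | base c u => simp [val, head, word, wordVal_vertex]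
  | snoc n e u ih => simp [val, head, word, wordVal_vertex, wordVal_edgeWord, ih, mul_assoc]

@[simp] theorem head_setHead (d : Gv (Λ.τ e₀)) (n : HigginsSeq Λ X e₀) :
    (n.setHead d).head = d := by
  induction n with
  | base c u => rfl
  | snoc n e u ih => exact ih

@[simp] theorem word_setHead (d : Gv (Λ.τ e₀)) (n : HigginsSeq Λ X e₀) :
    (n.setHead d).word T = n.word T := by
  induction n with
  | base c u => rfl
  | snoc n e u ih => simp [setHead, word, ih]

theorem endpt_setHead (d : Gv (Λ.τ e₀)) (n : HigginsSeq Λ X e₀) :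
    (n.setHead d).endpt = n.endpt := by
  cases n <;> rfl

theorem backtrack_setHead (d : Gv (Λ.τ e₀)) (n : HigginsSeq Λ X e₀) (e : E) :
    (n.setHead d).Backtrack e ↔ n.Backtrack e := by
  cases n <;> rfl

variable {R : WordTransversal 𝒢 X}

theorem isNormal_setHead {d : Gv (Λ.τ e₀)} (hd : d ∈ 𝒢.Ge e₀) {n : HigginsSeq Λ X e₀}
    (hn : n.IsNormal R) : (n.setHead d).IsNormal R := by
  induction n with
  | base c u => exact ⟨hd, hn.2⟩
  | snoc n e u ih =>
    refine ⟨ih hn.1, ?_, hn.2.2.1, ?_⟩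
    · rw [endpt_setHead]; exact hn.2.1
    · rw [backtrack_setHead]; exact hn.2.2.2

theorem head_mem {n : HigginsSeq Λ X e₀} (hn : n.IsNormal R) : n.head ∈ 𝒢.Ge e₀ := by
  induction n with
  | base c u => exact hn.1
  | snoc n e u ih => exact ih hn.1

theorem word_turn_of_mem {e : E} (he : e ∈ T) (hbar : Λ.bar e ∈ T) (n : HigginsSeq Λ X e₀) :
    (turn e n).word T = n.word T := by
  by_cases h : n.Backtrack e
  · obtain ⟨m, rfl⟩ := eq_snoc_of_backtrack h
    rw [turn_snoc_bar]
    simp [word, edgeWord_of_mem hbar]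
  · rw [turn_of_not_backtrack h]
    simp [word, edgeWord_of_mem he]

/-- Moving the end of a normal form along the tree changes neither its word nor its value. -/
theorem exists_endpt_eq (hT : Λ.IsMaximalTree T) {n : HigginsSeq Λ X e₀} (hn : n.IsNormal R)
    (v : V) : ∃ m : HigginsSeq Λ X e₀, m.IsNormal R ∧ m.endpt = v ∧ m.val 𝒢 T = n.val 𝒢 T ∧
      m.head = n.head ∧ m.word T = n.word T := by
  have h := isNormal_turns (hT.isPath_path n.endpt v) hn rfl
  refine ⟨_, h.1, h.2, val_turns_of_subset T (fun e he => hT.mem_of_mem_path he) n,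
    head_turns _ n, ?_⟩
  have : ∀ (p : List E) (m : HigginsSeq Λ X e₀), (∀ e ∈ p, e ∈ T) →
      (turns p m).word T = m.word T := by
    intro p
    induction p with
    | nil => intro _ _; rfl
    | cons e p ih =>
      intro m hp
      have he := hp e List.mem_cons_self
      exact (ih _ fun f hf => hp f (List.mem_cons_of_mem _ hf)).trans
        (word_turn_of_mem he (hT.bar_mem e he) m)
  exact this _ _ fun e he => hT.mem_of_mem_path he

/-- Normal forms of the same element have the same initial factor and the same word. -/
theorem head_word_eq (hT : Λ.IsMaximalTree T) {n m : HigginsSeq Λ X e₀} (hn : n.IsNormal R)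
    (hm : m.IsNormal R) (h : n.val 𝒢 T = m.val 𝒢 T) :
    n.head = m.head ∧ n.word T = m.word T := by
  obtain ⟨m', hm', hend, hval, hhead, hword⟩ := exists_endpt_eq hT hm n.endpt
  obtain rfl := eq_of_val_eq hn hm' hend.symm (h.trans hval.symm) hT
  exact ⟨hhead, hword⟩

end HigginsSeq

/-- The hypotheses on the edge groups: every `G_e = ⟨Y_e⟩` satisfies the conditions of
`IsShortlexPair`, and the isomorphisms `φ_e` are 1-stable. -/
structure IsShortlexGraph (𝒢 : GraphOfGroups Λ Gv) (X : ∀ v, Set (Gv v))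
    (Y : ∀ e, Set (Gv (Λ.τ e)))
    (lt : ∀ e, SymLetter (X (Λ.τ e)) → SymLetter (X (Λ.τ e)) → Prop) : Prop where
  pair : ∀ e, IsShortlexPair (Y e) (X (Λ.τ e)) (lt e)
  closure : ∀ e, Subgroup.closure (Y e) = 𝒢.Ge e
  stable : ∀ e, IsStableIso (𝒢.φ e) (Y e) (Y (Λ.bar e)) 1

namespace IsShortlexGraph

variable {Y : ∀ e, Set (Gv (Λ.τ e))}
  {lt : ∀ e, SymLetter (X (Λ.τ e)) → SymLetter (X (Λ.τ e)) → Prop}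
  (hS : IsShortlexGraph 𝒢 X Y lt)

include hS

theorem exists_rep (e : E) (g : Gv (Λ.τ e)) :
    ∃ w ∈ cosetShortlex Subtype.val (lt e) (𝒢.Ge e), g * (wordVal Subtype.val w)⁻¹ ∈ 𝒢.Ge e :=
  have := (hS.pair e).automatic.1
  have := (hS.pair e).finite
  exists_mem_cosetShortlex (lt e) (𝒢.Ge e) ((hS.pair e).exists_word g)

theorem eq_of_mul_inv_mem {e : E} {v w : List (SymLetter (X (Λ.τ e)))}
    (hv : v ∈ cosetShortlex Subtype.val (lt e) (𝒢.Ge e))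
    (hw : w ∈ cosetShortlex Subtype.val (lt e) (𝒢.Ge e))
    (h : wordVal Subtype.val w * (wordVal Subtype.val v)⁻¹ ∈ 𝒢.Ge e) : v = w :=
  have := (hS.pair e).automatic.1
  eq_of_mem_cosetShortlex hv hw ⟨_, h, by simp⟩

/-- The shortlex least coset representatives. -/
noncomputable def transversal : WordTransversal 𝒢 X where
  rep e g := (hS.exists_rep e g).choose
  residue_mem e g := (hS.exists_rep e g).choose_spec.2
  rep_mul e h hh g := by
    refine hS.eq_of_mul_inv_mem (hS.exists_rep e (h * g)).choose_spec.1
      (hS.exists_rep e g).choose_spec.1 ?_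
    have h₁ := (hS.exists_rep e (h * g)).choose_spec.2
    have h₂ := (hS.exists_rep e g).choose_spec.2
    simpa [mul_assoc] using mul_mem (mul_mem (inv_mem h₂) (inv_mem hh)) h₁
  rep_one e := by
    refine hS.eq_of_mul_inv_mem (hS.exists_rep e 1).choose_spec.1 nil_mem_cosetShortlex ?_
    simpa using (hS.exists_rep e 1).choose_spec.2

theorem rep_mem (e : E) (g : Gv (Λ.τ e)) :
    hS.transversal.rep e g ∈ cosetShortlex Subtype.val (lt e) (𝒢.Ge e) :=
  (hS.exists_rep e g).choose_spec.1

theorem rep_wordVal_iff {e : E} {u : List (SymLetter (X (Λ.τ e)))} :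
    hS.transversal.rep e (wordVal Subtype.val u) = u ↔
      u ∈ cosetShortlex Subtype.val (lt e) (𝒢.Ge e) := by
  constructor
  · intro h
    rw [← h]
    exact hS.rep_mem e _
  · intro h
    exact hS.eq_of_mul_inv_mem (hS.rep_mem e _) h (hS.transversal.residue_mem e _)

omit hS in
theorem higginsVal_symm (hT : Λ.IsMaximalTree T) (a : HigginsLetter X T) :
    ∃ b, higginsVal 𝒢 X T b = (higginsVal 𝒢 X T a)⁻¹ := by
  rcases a with ⟨v, a⟩ | ⟨e, he⟩
  · obtain ⟨b, hb⟩ := a.symm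
    exact ⟨Sum.inl ⟨v, b⟩, by simp [higginsVal, hb]⟩
  · refine ⟨Sum.inr ⟨Λ.bar e, fun h => he ?_⟩, 𝒢.s_bar T e⟩
    simpa [Λ.bar_bar] using hT.bar_mem _ h

theorem wordLengthLE_of_subgroup {e : E} {h : Gv (Λ.τ e)} {k : ℕ}
    (hh : WordLengthLE (α := SymLetter (Y e)) Subtype.val h k) :
    WordLengthLE (α := SymLetter (X (Λ.τ e))) Subtype.val h k :=
  WordLengthLE.map (val := Subtype.val) (val' := Subtype.val) (f := MonoidHom.id _)
    (ρ := SymLetter.incl (hS.pair e).subset) (fun _ => rfl) hh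

omit hS in
variable (𝒢 T) in
theorem wordLengthLE_ofVertex {v : V} {g : Gv v} {k : ℕ}
    (hg : WordLengthLE (α := SymLetter (X v)) Subtype.val g k) :
    WordLengthLE (higginsVal 𝒢 X T) (𝒢.ofVertex T v g) k :=
  hg.map (HigginsSeq.higginsVal_vertexLetter 𝒢 v)

end IsShortlexGraph

open HigginsSeq IsShortlexGraph

/-- Normal forms whose initial factors differ by at most one generator of `G_{e₀}`, and whose
words differ in length by at most one and `K`-fellow travel from the initial factors. -/
structure HigginsSeq.Close (𝒢 : GraphOfGroups Λ Gv) (Y : Set (Gv (Λ.τ e₀))) (T : Set E) (K : ℕ)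
    (n m : HigginsSeq Λ X e₀) : Prop where
  head : WordLengthLE (α := SymLetter Y) Subtype.val (n.head⁻¹ * m.head) 1
  length_le : (n.word T).length ≤ (m.word T).length + 1
  le_length : (m.word T).length ≤ (n.word T).length + 1
  fellowTravel : FellowTravel (higginsVal 𝒢 X T) K (𝒢.ofVertex T _ n.head) (n.word T)
    (𝒢.ofVertex T _ m.head) (m.word T)

namespace IsShortlexGraph

variable {Y : ∀ e, Set (Gv (Λ.τ e))}
  {lt : ∀ e, SymLetter (X (Λ.τ e)) → SymLetter (X (Λ.τ e)) → Prop}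
  (hS : IsShortlexGraph 𝒢 X Y lt)

include hS

theorem exists_uniform_fellowTravel [Finite E] : ∃ K : ℕ, ∀ e,
    ∀ u ∈ cosetShortlex Subtype.val (lt e) (𝒢.Ge e),
    ∀ u' ∈ cosetShortlex Subtype.val (lt e) (𝒢.Ge e), ∀ g h : Gv (Λ.τ e),
      WordLengthLE (α := SymLetter (X (Λ.τ e))) Subtype.val g 1 → h ∈ 𝒢.Ge e →
      wordVal Subtype.val u * g = h * wordVal Subtype.val u' →
      FellowTravel Subtype.val K 1 u h u' := by
  have h := fun e => (hS.pair e).exists_fellowTravel_cosetShortlex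
  simp only [hS.closure] at h
  choose K hK using h
  obtain ⟨B, hB⟩ := (Set.finite_range K).bddAbove
  exact ⟨B, fun e u hu u' hu' g k hg hk he =>
    (hK e u hu u' hu' g k hg hk he).mono (hB ⟨e, rfl⟩)⟩

/-- Multiplying a normal form by a generator of the vertex group at its end. The residue passed
on to the next syllable has length at most one, by 1-stability, and as soon as it is trivial the
rest of the normal form does not change. A syllable at which the residue is nontrivial keeps its
length, so the length changes at no more than one syllable. -/
theorem close_act (hT : Λ.IsMaximalTree T) {K : ℕ} (hK : ∀ e,
    ∀ u ∈ cosetShortlex Subtype.val (lt e) (𝒢.Ge e),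
    ∀ u' ∈ cosetShortlex Subtype.val (lt e) (𝒢.Ge e), ∀ g h : Gv (Λ.τ e),
      WordLengthLE (α := SymLetter (X (Λ.τ e))) Subtype.val g 1 → h ∈ 𝒢.Ge e →
      wordVal Subtype.val u * g = h * wordVal Subtype.val u' →
      FellowTravel Subtype.val K 1 u h u')
    {n : HigginsSeq Λ X e₀} (hn : n.IsNormal hS.transversal) {v : V} (hv : n.endpt = v) {g : Gv v}
    (hg : WordLengthLE (α := SymLetter (X v)) Subtype.val g 1) :
    n.Close 𝒢 (Y e₀) T (K + 2) (n.act hS.transversal ⟨v, g⟩) := by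
  set R := hS.transversal with hR
  have step : ∀ e (u : List (SymLetter (X (Λ.τ e)))) (g : Gv (Λ.τ e)),
      R.rep e (wordVal Subtype.val u) = u →
      WordLengthLE (α := SymLetter (X (Λ.τ e))) Subtype.val g 1 →
      WordLengthLE (α := SymLetter (Y e)) Subtype.val
        (R.residue e (wordVal Subtype.val u * g) : Gv (Λ.τ e)) 1 ∧
      (R.residue e (wordVal Subtype.val u * g) ≠ 1 →
        u.length = (R.rep e (wordVal Subtype.val u * g)).length) ∧
      u.length ≤ (R.rep e (wordVal Subtype.val u * g)).length + 1 ∧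
      (R.rep e (wordVal Subtype.val u * g)).length ≤ u.length + 1 ∧
      FellowTravel Subtype.val K 1 u (R.residue e (wordVal Subtype.val u * g) : Gv (Λ.τ e))
        (R.rep e (wordVal Subtype.val u * g)) := by
    intro e u g hu hg
    have hu := hS.rep_wordVal_iff.1 hu
    have hu' := hS.rep_mem e (wordVal Subtype.val u * g)
    have e1 := (R.residue_mul_rep e (wordVal Subtype.val u * g)).symm
    have hh := (R.residue e (wordVal Subtype.val u * g)).2
    have h := (hS.pair e).coset_step (by rw [hS.closure]; exact hu)
      (by rw [hS.closure]; exact hu') hg (by rw [hS.closure]; exact hh) e1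
    exact ⟨h.1, fun hne => h.2.1 fun h1 => hne (Subtype.ext h1), h.2.2.1, h.2.2.2,
      hK e u hu _ hu' g _ hg hh e1⟩
  induction n generalizing v with
  | base c u =>
    change Λ.τ e₀ = v at hv
    subst hv
    rw [act_base]
    obtain ⟨s₁, -, s₃, s₄, s₅⟩ := step e₀ u g hn.2 hg
    refine ⟨by simpa [head] using s₁, by simpa [word] using s₃, by simpa [word] using s₄, ?_⟩
    have := ((s₅.map (higginsVal_vertexLetter 𝒢 (T := T) _)).mul_left (𝒢.ofVertex T _ c)).mono
        (Nat.le_add_right K 2)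
    simpa [head, word] using this
  | snoc n e u ih =>
    change Λ.τ e = v at hv
    subst hv
    rw [act_snoc]
    obtain ⟨s₁, s₂, s₃, s₄, s₅⟩ := step e u g hn.2.2.1 hg
    set h := R.residue e (wordVal Subtype.val u * g)
    set u' := R.rep e (wordVal Subtype.val u * g)
    have hend : n.endpt = Λ.τ (Λ.bar e) := by rw [Λ.τ_bar, hn.2.1]
    have hφ := hS.wordLengthLE_of_subgroup (hS.stable e h s₁)
    have hc := ih hend hφ hn.1
    have hval := val_act T hn.1 hend (𝒢.φ e h : Gv (Λ.τ (Λ.bar e)))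
    have hlen : (n.word T).length + u.length ≤
          (word T (n.act R ⟨_, (𝒢.φ e h : Gv (Λ.τ (Λ.bar e)))⟩)).length + u'.length + 1 ∧
        (word T (n.act R ⟨_, (𝒢.φ e h : Gv (Λ.τ (Λ.bar e)))⟩)).length + u'.length ≤
          (n.word T).length + u.length + 1 := by
      by_cases h1 : h = 1
      · rw [h1, map_one, Subgroup.coe_one, act_one hn.1]
        omega
      · have := s₂ h1
        have := hc.length_le
        have := hc.le_length
        omega
    refine ⟨hc.head, ?_, ?_, ?_⟩
    · simp only [word, List.length_append, List.length_map]; omega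
    · simp only [word, List.length_append, List.length_map]; omega
    · refine (FellowTravel.append (K' := K + 1) (higginsVal_symm hT) hc.fellowTravel ?_
        hc.length_le hc.le_length).mono (by omega)
      rw [← val_eq, ← val_eq, hval]
      refine (FellowTravel.append (K := 1) (K' := K) (higginsVal_symm hT) ?_ ?_
        (Nat.le_succ _) (Nat.le_succ _)).mono (by omega)
      · have h₀ : WithinDist (higginsVal 𝒢 X T) 1 (n.val 𝒢 T)
            (n.val 𝒢 T * 𝒢.ofVertex T _ (𝒢.φ e h : Gv (Λ.τ (Λ.bar e)))) := by
          simpa [WithinDist] using wordLengthLE_ofVertex 𝒢 T hφ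
        intro t
        by_cases ht : edgeWord X T e = (edgeWord X T e).take t
        · rw [← ht, wordVal_edgeWord, mul_assoc _ _ (𝒢.s T e), ← 𝒢.s_mul_ofVertex,
            withinDist_mul_left_iff]
          simpa [WithinDist] using wordLengthLE_ofVertex 𝒢 T (hS.wordLengthLE_of_subgroup s₁)
        · have : (edgeWord X T e).take t = [] := by
            unfold edgeWord at ht ⊢
            split_ifs at ht ⊢
            · simp
            · cases t with
              | zero => simp
              | succ t => simp at ht
          rw [this]
          simpa using h₀
      · rw [wordVal_edgeWord, mul_assoc _ _ (𝒢.s T e), ← 𝒢.s_mul_ofVertex, ← mul_assoc]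
        simpa using (s₅.map (higginsVal_vertexLetter 𝒢 (T := T) _)).mul_left (n.val 𝒢 T * 𝒢.s T e)

omit hS in
theorem close_refl (Y : Set (Gv (Λ.τ e₀))) (K : ℕ) (n : HigginsSeq Λ X e₀) :
    n.Close 𝒢 Y T K n :=
  ⟨by simpa using WordLengthLE.one 1, Nat.le_succ _, Nat.le_succ _, FellowTravel.refl _ _ _⟩

omit hS in
theorem close_turn (hT : Λ.IsMaximalTree T) (Y : Set (Gv (Λ.τ e₀))) (K : ℕ) (e : E)
    (n : HigginsSeq Λ X e₀) : n.Close 𝒢 Y T (K + 2) (turn e n) := by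
  have hsymm := higginsVal_symm (𝒢 := 𝒢) (X := X) hT
  have hlen : ∀ f, (edgeWord X T f).length ≤ 1 := by
    intro f
    unfold edgeWord
    split_ifs <;> simp
  have key : ∀ (m : HigginsSeq Λ X e₀) f, FellowTravel (higginsVal 𝒢 X T) (K + 2)
      (𝒢.ofVertex T _ m.head) (m.word T) (𝒢.ofVertex T _ m.head)
      (m.word T ++ edgeWord X T f) := by
    intro m f
    have := FellowTravel.append (K' := 1) (q := []) (q' := edgeWord X T f) hsymm
      (FellowTravel.refl 0 (𝒢.ofVertex T _ m.head) (m.word T)) ?_ (Nat.le_succ _) (Nat.le_succ _)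
    · rw [List.append_nil] at this
      exact this.mono (by omega)
    · intro t
      rw [withinDist_mul_left_iff]
      refine ⟨(edgeWord X T f).take t, ?_, by simp⟩
      exact (List.length_take_le' _ _).trans (hlen f)
  have hhead := head_turn n e
  have hone : WordLengthLE (α := SymLetter Y) Subtype.val (n.head⁻¹ * (turn e n).head) 1 := by
    rw [hhead, inv_mul_cancel]
    exact WordLengthLE.one 1
  by_cases h : n.Backtrack e
  · obtain ⟨m, rfl⟩ := eq_snoc_of_backtrack h
    rw [turn_snoc_bar] at hone ⊢
    have := hlen (Λ.bar e)
    refine ⟨hone, ?_, ?_, ?_⟩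
    · simp only [word, List.length_append, List.map_nil, List.length_nil]; omega
    · simp only [word, List.length_append, List.map_nil, List.length_nil]; omega
    · simpa [word, head] using (key m (Λ.bar e)).symm hsymm
  · rw [turn_of_not_backtrack h] at hone ⊢
    have := hlen e
    refine ⟨hone, ?_, ?_, ?_⟩
    · simp only [word, List.length_append, List.map_nil, List.length_nil]; omega
    · simp only [word, List.length_append, List.map_nil, List.length_nil]; omega
    · simpa [word, head] using key n e

/-- Multiplying a normal form by an element of length at most one leads to a close normal
form. -/
theorem exists_close [Finite E] (hT : Λ.IsMaximalTree T) : ∃ K : ℕ, ∀ n : HigginsSeq Λ X e₀,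
    n.IsNormal hS.transversal → ∀ g : 𝒢.Pi1 T, WordLengthLE (higginsVal 𝒢 X T) g 1 →
      ∃ m : HigginsSeq Λ X e₀, m.IsNormal hS.transversal ∧ m.val 𝒢 T = n.val 𝒢 T * g ∧
        n.Close 𝒢 (Y e₀) T K m := by
  obtain ⟨K, hK⟩ := hS.exists_uniform_fellowTravel
  refine ⟨K + 2, fun n hn g hg => ?_⟩
  have transfer : ∀ {n n' m : HigginsSeq Λ X e₀}, n'.head = n.head → n'.word T = n.word T →
      n'.Close 𝒢 (Y e₀) T (K + 2) m → n.Close 𝒢 (Y e₀) T (K + 2) m := by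
    rintro n n' m h₁ h₂ ⟨c₁, c₂, c₃, c₄⟩
    rw [h₁] at c₁ c₄
    rw [h₂] at c₂ c₃ c₄
    exact ⟨c₁, c₂, c₃, c₄⟩
  obtain rfl | ⟨⟨v, a⟩ | ⟨e, he⟩, rfl⟩ := hg.eq_one_or_letter
  · exact ⟨n, hn, (mul_one _).symm, close_refl _ _ n⟩
  · obtain ⟨n', hn', hv, hval, hhead, hword⟩ := exists_endpt_eq hT hn v
    exact ⟨_, isNormal_act hn' ⟨v, a.1⟩, by rw [val_act T hn' hv, hval]; rfl,
      transfer hhead hword (hS.close_act hT hK hn' hv (WordLengthLE.letter a))⟩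
  · obtain ⟨n', hn', hv, hval, hhead, hword⟩ := exists_endpt_eq hT hn (Λ.ι e)
    exact ⟨_, (isNormal_turn hn' hv.symm).1, by rw [val_turn, hval]; rfl,
      transfer hhead hword (close_turn hT _ K e n')⟩

end IsShortlexGraph

end Geometry

/-! ### The Higgins coset language -/

section HigginsLanguage

variable {V E : Type*} {Λ : OppGraph V E} {Gv : V → Type*} [∀ v, Group (Gv v)]
  {𝒢 : GraphOfGroups Λ Gv} {X : ∀ v, Set (Gv v)} {e₀ : E} {T : Set E}

namespace HigginsSeq

/-- The sequence with trivial initial factor given by its list of syllables. -/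
def ofList (u₀ : List (SymLetter (X (Λ.τ e₀)))) (q : List (Σ e : E, List (SymLetter (X (Λ.τ e))))) :
    HigginsSeq Λ X e₀ :=
  q.foldl (fun n a => snoc n a.1 a.2) (base 1 u₀)

theorem ofList_append (u₀ : List (SymLetter (X (Λ.τ e₀))))
    (q : List (Σ e : E, List (SymLetter (X (Λ.τ e))))) (a) :
    ofList u₀ (q ++ [a]) = snoc (ofList u₀ q) a.1 a.2 := by
  simp [ofList]

theorem exists_eq_ofList {n : HigginsSeq Λ X e₀} (hn : n.head = 1) :
    ∃ u₀ q, n = ofList u₀ q := by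
  induction n with
  | base c u =>
    obtain rfl : c = 1 := hn
    exact ⟨u, [], rfl⟩
  | snoc n e u ih =>
    obtain ⟨u₀, q, rfl⟩ := ih hn
    exact ⟨u₀, q ++ [⟨e, u⟩], (ofList_append u₀ q ⟨e, u⟩).symm⟩

theorem head_ofList (u₀ : List (SymLetter (X (Λ.τ e₀))))
    (q : List (Σ e : E, List (SymLetter (X (Λ.τ e))))) : (ofList u₀ q).head = 1 := by
  induction q using List.reverseRecOn with
  | nil => rfl
  | append_singleton q a ih => rw [ofList_append]; exact ih

theorem endpt_ofList {u₀ : List (SymLetter (X (Λ.τ e₀)))}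
    {q : List (Σ e : E, List (SymLetter (X (Λ.τ e))))} {v : V}
    (h : Λ.IsPath (Λ.τ e₀) v (q.map Sigma.fst)) : (ofList u₀ q).endpt = v := by
  induction q using List.reverseRecOn generalizing v with
  | nil => exact h
  | append_singleton q a ih =>
    rw [List.map_append, OppGraph.isPath_append] at h
    obtain ⟨w, -, -, h⟩ := h
    rw [ofList_append]
    exact h

theorem backtrack_ofList {u₀ : List (SymLetter (X (Λ.τ e₀)))}
    {q : List (Σ e : E, List (SymLetter (X (Λ.τ e))))} {e : E} :
    (ofList u₀ q).Backtrack e ↔ ∃ a ∈ q.getLast?, a.1 = Λ.bar e ∧ a.2 = [] := by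
  induction q using List.reverseRecOn with
  | nil => simp [ofList, Backtrack]
  | append_singleton q a ih => simp [ofList_append, Backtrack]

theorem isNormal_ofList_iff {R : WordTransversal 𝒢 X} {u₀ : List (SymLetter (X (Λ.τ e₀)))}
    {q : List (Σ e : E, List (SymLetter (X (Λ.τ e))))} :
    (ofList u₀ q).IsNormal R ↔ (∃ v, Λ.IsPath (Λ.τ e₀) v (q.map Sigma.fst)) ∧
      R.rep e₀ (wordVal Subtype.val u₀) = u₀ ∧
      (∀ a ∈ q, R.rep a.1 (wordVal Subtype.val a.2) = a.2) ∧
      q.IsChain (fun a b => b.1 = Λ.bar a.1 → wordVal Subtype.val a.2 ∉ 𝒢.Ge a.1) := by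
  induction q using List.reverseRecOn with
  | nil => simp [ofList, IsNormal, OppGraph.IsPath]
  | append_singleton q a ih =>
    rw [ofList_append, IsNormal, ih, List.isChain_append, List.map_append]
    simp only [backtrack_ofList, List.mem_append, List.mem_singleton]
    constructor
    · rintro ⟨⟨⟨v, hp⟩, h₁, h₂, h₃⟩, h₄, h₅, h₆⟩
      refine ⟨⟨Λ.τ a.1, Λ.isPath_append.2 ⟨v, hp, ?_, rfl⟩⟩, h₁, ?_, h₃, by simp, ?_⟩
      · rw [h₄, endpt_ofList hp]
      · rintro b (hb | rfl)
        exacts [h₂ b hb, h₅]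
      · rintro b hb c hc hbar hmem
        obtain rfl : a = c := by simpa using hc
        refine h₆ ⟨b, hb, by rw [hbar, Λ.bar_bar], ?_⟩
        rw [← h₂ b (List.mem_of_mem_getLast? hb), R.rep_of_mem hmem]
    · rintro ⟨⟨v, hp⟩, h₁, h₂, h₃, -, h₄⟩
      obtain ⟨w, hp, h₅, -⟩ := Λ.isPath_append.1 hp
      refine ⟨⟨⟨w, hp⟩, h₁, fun b hb => h₂ b (Or.inl hb), h₃⟩, ?_, h₂ a (Or.inr rfl), ?_⟩
      · rw [endpt_ofList hp]; exact h₅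
      · rintro ⟨b, hb, hbar, hnil⟩
        refine h₄ b hb a rfl (by rw [hbar, Λ.bar_bar]) ?_
        rw [hnil]
        exact one_mem _

theorem deflate_append (v w : List (InflatedLetter E X)) :
    deflate X T (v ++ w) = deflate X T v ++ deflate X T w :=
  List.filterMap_append

theorem deflate_vertexWord (v : V) (u : List (SymLetter (X v))) :
    deflate X T (vertexWord E X v u) = u.map (vertexLetter X T v) := by
  induction u with
  | nil => rfl
  | cons a u ih =>
    have : deflate X T (vertexWord E X v (a :: u)) =
        vertexLetter X T v a :: deflate X T (vertexWord E X v u) := rfl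
    rw [this, ih, List.map_cons]

theorem deflate_edge_cons (e : E) (w : List (InflatedLetter E X)) :
    deflate X T (Sum.inr e :: w) = edgeWord X T e ++ deflate X T w := by
  by_cases h : e ∈ T <;> simp [deflate, edgeWord, h]

theorem deflate_eq_word_ofList (u₀ : List (SymLetter (X (Λ.τ e₀))))
    (q : List (Σ e : E, List (SymLetter (X (Λ.τ e))))) :
    deflate X T (vertexWord E X (Λ.τ e₀) u₀ ++
      q.flatMap (fun a => Sum.inr a.1 :: vertexWord E X (Λ.τ a.1) a.2)) =
        (ofList u₀ q).word T := by
  induction q using List.reverseRecOn with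
  | nil => simp [ofList, word, deflate_vertexWord]
  | append_singleton q a ih =>
    rw [List.flatMap_append, ← List.append_assoc, deflate_append, ih, ofList_append]
    simp [word, deflate_edge_cons, deflate_vertexWord]

/-- The last syllable, if there is one, is not deleted as a whole by the deflation. -/
def Stripped (T : Set E) : HigginsSeq Λ X e₀ → Prop
  | base _ _ => True
  | snoc _ e u => e ∈ T → u ≠ []

theorem exists_stripped {R : WordTransversal 𝒢 X} {n : HigginsSeq Λ X e₀} (hn : n.IsNormal R) :
    ∃ m : HigginsSeq Λ X e₀, m.IsNormal R ∧ m.Stripped T ∧ m.head = n.head ∧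
      m.word T = n.word T := by
  induction n with
  | base c u => exact ⟨_, hn, trivial, rfl, rfl⟩
  | snoc n e u ih =>
    by_cases h : e ∈ T ∧ u = []
    · obtain ⟨he, rfl⟩ := h
      obtain ⟨m, h₁, h₂, h₃, h₄⟩ := ih hn.1
      exact ⟨m, h₁, h₂, h₃, by simp [h₄, word, edgeWord_of_mem he]⟩
    · exact ⟨_, hn, fun he hu => h ⟨he, hu⟩, rfl, rfl⟩

theorem stripped_ofList {u₀ : List (SymLetter (X (Λ.τ e₀)))}
    {q : List (Σ e : E, List (SymLetter (X (Λ.τ e))))} :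
    (ofList u₀ q).Stripped T ↔ ∀ a ∈ q.getLast?, a.1 ∈ T → a.2 ≠ [] := by
  induction q using List.reverseRecOn with
  | nil => simp [ofList, Stripped]
  | append_singleton q a ih => simp [ofList_append, Stripped]

/-- The conditions of `HigginsSeq.IsNormal`, except that the last word may be arbitrary. -/
def IsNormalUpToLast (R : WordTransversal 𝒢 X) : HigginsSeq Λ X e₀ → Prop
  | base c _ => c ∈ 𝒢.Ge e₀
  | snoc n e _ => n.IsNormal R ∧ Λ.ι e = n.endpt ∧ ¬ n.Backtrack e

end HigginsSeq

namespace IsShortlexGraph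

open HigginsSeq

variable {Y : ∀ e, Set (Gv (Λ.τ e))}
  {lt : ∀ e, SymLetter (X (Λ.τ e)) → SymLetter (X (Λ.τ e)) → Prop}
  (hS : IsShortlexGraph 𝒢 X Y lt)

include hS

/-- The Higgins coset language consists of the words of the normal forms with trivial initial
factor. The condition on trailing syllables in its definition removes no words, since dropping a
syllable `s_e` with `e` in the tree does not change the deflated word. -/
theorem mem_higginsCosetLanguage_iff {w : List (HigginsLetter X T)} :
    w ∈ higginsCosetLanguage 𝒢 X (fun e => cosetShortlex Subtype.val (lt e) (𝒢.Ge e)) e₀ T ↔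
      ∃ n : HigginsSeq Λ X e₀, n.IsNormal hS.transversal ∧ n.head = 1 ∧ n.word T = w := by
  constructor
  · rintro ⟨_, ⟨u₀, q, hp, hu₀, hq, hc, -, rfl⟩, rfl⟩
    refine ⟨ofList u₀ q, isNormal_ofList_iff.2 ⟨hp, hS.rep_wordVal_iff.2 hu₀, ?_, hc⟩,
      head_ofList u₀ q, (deflate_eq_word_ofList u₀ q).symm⟩
    exact fun a ha => hS.rep_wordVal_iff.2 (hq a ha)
  · rintro ⟨n, hn, hhead, rfl⟩
    obtain ⟨m, hm, hstr, hhead', hword⟩ := exists_stripped (T := T) hn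
    obtain ⟨u₀, q, rfl⟩ := exists_eq_ofList (hhead'.trans hhead)
    obtain ⟨hp, hu₀, hq, hc⟩ := isNormal_ofList_iff.1 hm
    refine ⟨_, ⟨u₀, q, hp, hS.rep_wordVal_iff.1 hu₀, fun a ha => hS.rep_wordVal_iff.1 (hq a ha),
      hc, ?_, rfl⟩, ?_⟩
    · intro a ha hT hmem
      refine stripped_ofList.1 hstr a ha hT ?_
      rw [← hq a (List.mem_of_mem_getLast? ha), hS.transversal.rep_of_mem hmem]
    · rw [deflate_eq_word_ofList, hword]

/-- The automaton of the Higgins coset language. A state `(e, q, b)` consists of the last edge, the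
state of the automaton for the coset representatives of `G_e` after reading the last word, and the
truth value of "the last syllable is `s_e`". The symbols of tree edges are read silently. -/
def higginsAutomaton {σ : E → Type} (M : ∀ e, DFA (SymLetter (X (Λ.τ e))) (σ e)) (e₀ : E)
    (T : Set E) : εNFA (HigginsLetter X T) (Σ e, σ e × Bool) where
  step s x := {t | (∃ a, x = some (vertexLetter X T _ a) ∧
      t = ⟨s.1, (M s.1).step s.2.1 a, false⟩) ∨
    ∃ f, edgeWord X T f = x.toList ∧ s.2.1 ∈ (M s.1).accept ∧ Λ.ι f = Λ.τ s.1 ∧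
      ¬ (s.2.2 = true ∧ s.1 = Λ.bar f) ∧ t = ⟨f, (M f).start, true⟩}
  start := {⟨e₀, (M e₀).start, false⟩}
  accept := {s | s.2.1 ∈ (M s.1).accept}

/-- The state reached by reading the word of a sequence. -/
def automatonState {σ : E → Type} (M : ∀ e, DFA (SymLetter (X (Λ.τ e))) (σ e)) :
    HigginsSeq Λ X e₀ → Σ e, σ e × Bool
  | base _ u => ⟨e₀, (M e₀).eval u, false⟩
  | snoc _ e u => ⟨e, (M e).eval u, u.isEmpty⟩

theorem isRegular_higginsCosetLanguage [Finite E] :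
    (higginsCosetLanguage 𝒢 X (fun e => cosetShortlex Subtype.val (lt e) (𝒢.Ge e)) e₀
      T).IsRegular := by
  have hreg := fun e => (hS.pair e).isRegular_cosetShortlex
  simp only [hS.closure] at hreg
  choose σ hσ M hM using hreg
  have hacc : ∀ e u, (M e).eval u ∈ (M e).accept ↔
      hS.transversal.rep e (wordVal Subtype.val u) = u := by
    intro e u
    rw [hS.rep_wordVal_iff, ← hM e]
    rfl
  have hL : higginsCosetLanguage 𝒢 X (fun e => cosetShortlex Subtype.val (lt e) (𝒢.Ge e)) e₀ T =
      (higginsAutomaton (X := X) M e₀ T).accepts := by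
    ext w
    rw [hS.mem_higginsCosetLanguage_iff]
    constructor
    · rintro ⟨n, hn, -, rfl⟩
      have letters : ∀ (e : E) (b : List (SymLetter (X (Λ.τ e))) → Bool)
          (x : List (HigginsLetter X T)),
          (∀ (u : List (SymLetter (X (Λ.τ e)))) a, b (u ++ [a]) = false) →
          ⟨e, (M e).start, b []⟩ ∈ (higginsAutomaton (X := X) M e₀ T).eval x →
          ∀ u : List (SymLetter (X (Λ.τ e))), ⟨e, (M e).eval u, b u⟩ ∈
            (higginsAutomaton (X := X) M e₀ T).eval (x ++ u.map (vertexLetter X T _)) := by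
        intro e b x hb hx u
        induction u using List.reverseRecOn with
        | nil => simpa using hx
        | append_singleton u a ih =>
          rw [List.map_append, ← List.append_assoc]
          refine εNFA.mem_eval_of_step_some ih (Or.inl ⟨a, rfl, ?_⟩)
          simp [hb]
      have reach : automatonState M n ∈
          (higginsAutomaton (X := X) M e₀ T).eval (n.word T) := by
        induction n with
        | base c u =>
          exact letters e₀ (fun _ => false) [] (fun _ _ => rfl) (εNFA.εClosure.base _ rfl) u
        | snoc n e u ih =>
          rw [word, ← List.append_assoc]
          refine letters e List.isEmpty _ (by simp) ?_ u
          have hstep : ∀ x : Option (HigginsLetter X T), edgeWord X T e = x.toList →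
              (⟨e, (M e).start, true⟩ : Σ e, σ e × Bool) ∈
                (higginsAutomaton (X := X) M e₀ T).step (automatonState M n) x := by
            intro x hx
            refine Or.inr ⟨e, hx, ?_⟩
            cases n with
            | base c v =>
              exact ⟨(hacc _ _).2 hn.1.2, hn.2.1, by simp [automatonState], rfl⟩
            | snoc m f v =>
              refine ⟨(hacc _ _).2 hn.1.2.2.1, hn.2.1, fun h => hn.2.2.2 ⟨h.2, ?_⟩, rfl⟩
              simpa [automatonState] using h.1
          by_cases he : e ∈ T
          · have hw := edgeWord_of_mem (X := X) he
            rw [hw, List.append_nil]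
            exact εNFA.mem_eval_of_step_none (ih hn.1) (hstep none hw)
          · have hw : edgeWord X T e = [Sum.inr ⟨e, he⟩] := dif_neg he
            rw [hw]
            exact εNFA.mem_eval_of_step_some (ih hn.1) (hstep (some _) hw)
      refine ⟨_, ?_, reach⟩
      cases n with
      | base c u => exact (hacc _ _).2 hn.2
      | snoc n e u => exact (hacc _ _).2 hn.2.2.1
    · rintro ⟨s, hs, hw⟩
      let P : List (HigginsLetter X T) → (Σ e, σ e × Bool) → Prop := fun x s =>
        ∃ n : HigginsSeq Λ X e₀, n.IsNormalUpToLast hS.transversal ∧ n.head = 1 ∧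
          n.word T = x ∧ automatonState M n = s
      have hnormal : ∀ n : HigginsSeq Λ X e₀, n.IsNormalUpToLast hS.transversal →
          (automatonState M n).2.1 ∈ (M (automatonState M n).1).accept →
          n.IsNormal hS.transversal := by
        intro n hn h
        cases n with
        | base c u => exact ⟨hn, (hacc _ _).1 h⟩
        | snoc n e u => exact ⟨hn.1, hn.2.1, (hacc _ _).1 h, hn.2.2⟩
      have hstep : ∀ x s t (y : Option (HigginsLetter X T)), P x s →
          t ∈ (higginsAutomaton (X := X) M e₀ T).step s y → P (x ++ y.toList) t := by
        rintro _ _ t y ⟨n, hn, hhead, rfl, rfl⟩ (⟨a, rfl, rfl⟩ | ⟨f, hf, ha, hι, hb, rfl⟩)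
        · cases n with
          | base c u =>
            change SymLetter (X (Λ.τ e₀)) at a
            exact ⟨base c (u ++ [a]), hn, hhead, by simp [word, automatonState],
              by simp [automatonState]⟩
          | snoc n e u =>
            change SymLetter (X (Λ.τ e)) at a
            exact ⟨snoc n e (u ++ [a]), hn, hhead, by simp [word, automatonState],
              by simp [automatonState]⟩
        · refine ⟨snoc n f [], ⟨hnormal n hn ha, ?_, ?_⟩, hhead, ?_, rfl⟩
          · rw [hι]
            cases n <;> rfl
          · cases n with
            | base c u => exact id
            | snoc n e u =>
              rintro ⟨h₁, rfl⟩
              exact hb ⟨rfl, h₁⟩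
          · simp [word, hf]
      have hP : P w s := by
        refine εNFA.eval_induction (P := P) ?_ ?_ ?_ hw
        · rintro _ rfl
          exact ⟨base 1 [], one_mem (𝒢.Ge e₀), rfl, rfl, rfl⟩
        · intro x s t h ht
          simpa using hstep x s t none h ht
        · intro x s a t h ht
          exact hstep x s t (some a) h ht
      obtain ⟨n, hn, hhead, rfl, rfl⟩ := hP
      exact ⟨n, hnormal n hn hs, hhead, rfl⟩
  rw [hL]
  exact εNFA.isRegular_accepts _

end IsShortlexGraph

end HigginsLanguage

/-! ### Coset automaticity and automaticity of the fundamental group -/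

section Automatic

variable {V E : Type*} {Λ : OppGraph V E} {Gv : V → Type*} [∀ v, Group (Gv v)]
  {𝒢 : GraphOfGroups Λ Gv} {X : ∀ v, Set (Gv v)} {e₀ : E} {T : Set E}

open HigginsSeq

theorem finite_symLetter {G : Type*} [Group G] {S : Set G} (hS : S.Finite) :
    Finite (SymLetter S) :=
  Set.Finite.to_subtype (s := {g | g ∈ S ∨ g⁻¹ ∈ S}) (hS.union hS.inv)

theorem exists_higgins_word (hX : ∀ v, Subgroup.closure (X v) = ⊤) (hT : Λ.IsMaximalTree T)
    (g : 𝒢.Pi1 T) : ∃ w, wordVal (higginsVal 𝒢 X T) w = g := by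
  have hg : g ∈ Subgroup.closure (Set.range (PresentedGroup.of (rels := {r | 𝒢.Relator T r}))) := by
    rw [PresentedGroup.closure_range_of]
    trivial
  induction hg using Subgroup.closure_induction with
  | mem x hx =>
    obtain ⟨⟨v, g⟩ | e, rfl⟩ := hx
    · obtain ⟨w, rfl⟩ := exists_wordVal_of_mem_closure (S := X v) (g := g) (by rw [hX]; trivial)
      exact ⟨_, wordVal_vertex 𝒢 v w⟩
    · exact ⟨_, wordVal_edgeWord 𝒢 (X := X) e⟩
  | one => exact ⟨[], rfl⟩
  | mul x y _ _ hx hy =>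
    obtain ⟨v, rfl⟩ := hx
    obtain ⟨w, rfl⟩ := hy
    exact ⟨v ++ w, wordVal_append v w⟩
  | inv x _ hx =>
    obtain ⟨v, hv⟩ := hx
    obtain ⟨w, -, hw⟩ := WordLengthLE.inv (IsShortlexGraph.higginsVal_symm hT) ⟨v, le_rfl, hv⟩
    exact ⟨w, hw⟩

namespace IsShortlexGraph

theorem isSymmGenerating_higginsVal [Finite V] [Finite E] (hfin : ∀ v, (X v).Finite)
    (hX : ∀ v, Subgroup.closure (X v) = ⊤) (hT : Λ.IsMaximalTree T) :
    IsSymmGenerating (higginsVal 𝒢 X T) where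
  finite :=
    have := fun v => finite_symLetter (hfin v)
    inferInstance
  symm := higginsVal_symm hT
  generates := exists_higgins_word hX hT

variable {Y : ∀ e, Set (Gv (Λ.τ e))}
  {lt : ∀ e, SymLetter (X (Λ.τ e)) → SymLetter (X (Λ.τ e)) → Prop}
  (hS : IsShortlexGraph 𝒢 X Y lt)

include hS

/-- Every element of word length `k` has a normal form whose word has length at most `k`. -/
theorem exists_isNormal_val_eq [Finite E] (hT : Λ.IsMaximalTree T)
    (w : List (HigginsLetter X T)) : ∃ n : HigginsSeq Λ X e₀, n.IsNormal hS.transversal ∧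
      n.val 𝒢 T = wordVal (higginsVal 𝒢 X T) w ∧ (n.word T).length ≤ w.length := by
  obtain ⟨K, hK⟩ := hS.exists_close (e₀ := e₀) hT
  induction w using List.reverseRecOn with
  | nil => exact ⟨base 1 [], (basePoint hS.transversal e₀).2.1, by simp [val], by simp [word]⟩
  | append_singleton w a ih =>
    obtain ⟨n, hn, hval, hlen⟩ := ih
    obtain ⟨m, hm, hval', hc⟩ := hK n hn _ (WordLengthLE.letter a)
    refine ⟨m, hm, by simp [hval', hval], hc.le_length.trans ?_⟩
    simpa using hlen

omit hS in
/-- Changing the initial factor of a normal form by left multiplication with an element of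
`G_{e₀}`. -/
theorem val_setHead {n : HigginsSeq Λ X e₀} (hn : n.head = 1) (d : Gv (Λ.τ e₀)) :
    (n.setHead d).val 𝒢 T = 𝒢.ofVertex T _ d * n.val 𝒢 T := by
  rw [val_eq, val_eq, head_setHead, word_setHead, hn, map_one, one_mul]

theorem isCosetGeodesic_of_mem [Finite E] (hT : Λ.IsMaximalTree T)
    {w : List (HigginsLetter X T)} (hw : w ∈ higginsCosetLanguage 𝒢 X
      (fun e => cosetShortlex Subtype.val (lt e) (𝒢.Ge e)) e₀ T) :
    IsCosetGeodesic (higginsVal 𝒢 X T) (𝒢.edgeSubgroup T e₀) w := by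
  obtain ⟨n, hn, hhead, rfl⟩ := hS.mem_higginsCosetLanguage_iff.1 hw
  rintro w' ⟨_, ⟨d, hd, rfl⟩, e⟩
  obtain ⟨m, hm, hval, hlen⟩ := hS.exists_isNormal_val_eq (e₀ := e₀) hT w'
  have := (head_word_eq hT hm (isNormal_setHead hd hn) (by
    rw [hval, e, val_setHead hhead, val_eq n, hhead, map_one, one_mul])).2
  rw [word_setHead] at this
  rwa [← this]

theorem isStrongSynchCosetAutomatic [Finite V] [Finite E] (hfin : ∀ v, (X v).Finite)
    (hX : ∀ v, Subgroup.closure (X v) = ⊤) (hT : Λ.IsMaximalTree T) (hY : (Y e₀).Finite) :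
    IsStrongSynchCosetAutomatic (higginsVal 𝒢 X T) (𝒢.edgeSubgroup T e₀)
      (higginsCosetLanguage 𝒢 X (fun e => cosetShortlex Subtype.val (lt e) (𝒢.Ge e)) e₀ T) where
  generating := isSymmGenerating_higginsVal hfin hX hT
  fg := by
    have : (𝒢.Ge e₀).FG := (Subgroup.fg_iff _).2 ⟨Y e₀, hS.closure e₀, hY⟩
    obtain ⟨S, hS⟩ := this
    classical
    exact ⟨S.image (𝒢.ofVertex T _), by rw [Finset.coe_image, ← MonoidHom.map_closure, hS]; rfl⟩
  coset_language g := by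
    obtain ⟨w, rfl⟩ := exists_higgins_word hX hT g
    obtain ⟨n, hn, hval, -⟩ := hS.exists_isNormal_val_eq (e₀ := e₀) hT w
    refine ⟨_, hS.mem_higginsCosetLanguage_iff.2
      ⟨n.setHead 1, isNormal_setHead (one_mem _) hn, head_setHead 1 n, rfl⟩,
      𝒢.ofVertex T _ n.head⁻¹, ⟨_, inv_mem (head_mem hn), rfl⟩, ?_⟩
    rw [word_setHead, ← hval, val_eq, map_inv, inv_mul_cancel_left]
  regular := hS.isRegular_higginsCosetLanguage
  fellow_travel := by
    obtain ⟨K, hK⟩ := hS.exists_close (e₀ := e₀) hT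
    refine ⟨K, ?_⟩
    rintro v hv w hw _ ⟨d, hd, rfl⟩ hdist
    obtain ⟨n, hn, hhead, rfl⟩ := hS.mem_higginsCosetLanguage_iff.1 hv
    obtain ⟨m, hm, hhead', rfl⟩ := hS.mem_higginsCosetLanguage_iff.1 hw
    obtain ⟨m', hm', hval, hc⟩ := hK n hn _ hdist
    obtain ⟨h₁, h₂⟩ := head_word_eq hT hm' (isNormal_setHead hd hm) (by
      rw [hval, val_setHead hhead', val_eq n, val_eq m, hhead, hhead', map_one, one_mul,
        one_mul, mul_inv_cancel_left])
    have := hc.fellowTravel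
    rw [h₁, h₂, head_setHead, word_setHead, hhead, map_one] at this
    exact synchFellowTravel_iff.2 this

/-- The language of the automatic structure is `SL(G_{e₀}) · L`, where `L` is the Higgins coset
language: two adjacent elements have normal forms whose initial factors are adjacent in `G_{e₀}`,
so that the two parts of the words fellow travel one after the other. -/
theorem isAutomaticGroup [Finite V] [Finite E] (hfin : ∀ v, (X v).Finite)
    (hX : ∀ v, Subgroup.closure (X v) = ⊤) (hT : Λ.IsMaximalTree T) (e₀ : E) :
    IsAutomaticGroup (𝒢.Pi1 T) := by
  have hgen := isSymmGenerating_higginsVal (𝒢 := 𝒢) hfin hX hT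
  have := hgen.finite
  let S : Set (𝒢.Pi1 T) := Set.range (higginsVal 𝒢 X T)
  let ρ : HigginsLetter X T → SymLetter S := fun a => ⟨higginsVal 𝒢 X T a, Or.inl ⟨a, rfl⟩⟩
  have hρ : ∀ a, (ρ a).1 = MonoidHom.id _ (higginsVal 𝒢 X T a) := fun _ => rfl
  let L₀ : Language (SymLetter (X (Λ.τ e₀))) := {z | z ∈ shortlexWords Subtype.val (lt e₀) ∧
    ∀ a ∈ z, a.1 ∈ Y e₀ ∨ a.1⁻¹ ∈ Y e₀}
  let L₁ : Language (HigginsLetter X T) := {x | ∃ z ∈ L₀, x = z.map (vertexLetter X T _)}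
  let L := higginsCosetLanguage 𝒢 X (fun e => cosetShortlex Subtype.val (lt e) (𝒢.Ge e)) e₀ T
  refine ⟨S, ({x | ∃ y ∈ L₁ * L, x = y.map ρ} : Language (SymLetter S)), ?_, ?_, ?_, ?_, ?_⟩
  · refine ⟨finite_symLetter (Set.finite_range _), SymLetter.symm, fun g => ?_⟩
    obtain ⟨w, rfl⟩ := hgen.generates g
    exact ⟨w.map ρ, wordVal_map hρ w⟩
  · exact Subgroup.FG.bot
  · intro g
    obtain ⟨w, rfl⟩ := hgen.generates g
    obtain ⟨n, hn, hval, -⟩ := hS.exists_isNormal_val_eq (e₀ := e₀) hT w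
    have := (hS.pair e₀).automatic.1
    have := (hS.pair e₀).finite
    obtain ⟨z, hz, hzval⟩ := exists_mem_shortlexWords (lt e₀) ((hS.pair e₀).exists_word n.head)
    · refine ⟨_, ⟨_, ⟨_, ⟨z, ⟨hz, (hS.pair e₀).letters_of_mem_closure hz ?_⟩, rfl⟩, _,
        hS.mem_higginsCosetLanguage_iff.2 ⟨n.setHead 1, isNormal_setHead (one_mem _) hn,
          head_setHead 1 n, rfl⟩, rfl⟩, rfl⟩, 1, one_mem _, ?_⟩
      · rw [hzval, hS.closure]
        exact head_mem hn
      · rw [wordVal_map hρ, MonoidHom.id_apply, wordVal_append, wordVal_vertex, hzval,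
          word_setHead, ← val_eq, hval, one_mul]
  · exact (((hS.pair e₀).isRegular_subgroup_words.image_map _).concat
      hS.isRegular_higginsCosetLanguage).image_map ρ
  · obtain ⟨K, hK⟩ := hS.exists_close (e₀ := e₀) hT
    obtain ⟨K₁, hK₁⟩ := (hS.pair e₀).exists_fellowTravel_shortlexWords
    refine ⟨max K₁ (K + 1), ?_⟩
    rintro _ ⟨_, ⟨_, ⟨z, hz, rfl⟩, v, hv, rfl⟩, rfl⟩ _ ⟨_, ⟨_, ⟨y, hy, rfl⟩, w, hw, rfl⟩, rfl⟩ h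
      hh hdist
    obtain rfl : h = 1 := hh
    obtain ⟨n, hn, hhead, rfl⟩ := hS.mem_higginsCosetLanguage_iff.1 hv
    obtain ⟨m, hm, hhead', rfl⟩ := hS.mem_higginsCosetLanguage_iff.1 hw
    have mem : ∀ x ∈ L₀, wordVal Subtype.val x ∈ 𝒢.Ge e₀ := by
      rintro x ⟨-, hx⟩
      rw [← hS.closure]
      clear * - hx
      induction x with
      | nil => exact one_mem _
      | cons a x ih =>
        rw [wordVal_cons]
        refine mul_mem ?_ (ih fun b hb => hx b (List.mem_cons_of_mem _ hb))
        rcases hx a List.mem_cons_self with h | h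
        · exact Subgroup.subset_closure h
        · exact inv_mem_iff.1 (Subgroup.subset_closure h)
    have valn : ∀ (k : HigginsSeq Λ X e₀) (x : List (SymLetter (X (Λ.τ e₀)))), k.head = 1 →
        wordVal Subtype.val ((x.map (vertexLetter X T _) ++ k.word T).map ρ) =
          (k.setHead (wordVal Subtype.val x)).val 𝒢 T := by
      intro k x hk
      rw [wordVal_map hρ, MonoidHom.id_apply, wordVal_append, wordVal_vertex,
        val_setHead hk, val_eq k, hk, map_one, one_mul]
    obtain ⟨g, hg, hval⟩ : ∃ g, WordLengthLE (higginsVal 𝒢 X T) g 1 ∧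
        (n.setHead (wordVal Subtype.val z)).val 𝒢 T * g =
          (m.setHead (wordVal Subtype.val y)).val 𝒢 T := by
      rw [one_mul, valn n z hhead, valn m y hhead'] at hdist
      refine ⟨_, ?_, mul_inv_cancel_left _ _⟩
      have hr : ∀ a : SymLetter S, ∃ b, higginsVal 𝒢 X T b = MonoidHom.id _ a.1 := by
        rintro ⟨a, ⟨b, rfl⟩ | ⟨b, hb⟩⟩
        · exact ⟨b, rfl⟩
        · obtain ⟨c, hc⟩ := hgen.symm b
          exact ⟨c, by rw [hc, hb, inv_inv]; rfl⟩
      choose r hr using hr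
      exact WordLengthLE.map (f := MonoidHom.id _) hr hdist
    obtain ⟨m', hm', hval', hc⟩ := hK _ (isNormal_setHead (mem z hz) hn) g hg
    obtain ⟨h₁, h₂⟩ := head_word_eq hT hm' (isNormal_setHead (mem y hy) hm) (hval'.trans hval)
    obtain ⟨c₁, -, -, c₄⟩ := hc
    rw [h₁] at c₁ c₄
    rw [h₂] at c₄
    simp only [head_setHead, word_setHead] at c₁ c₄
    have c₁' := hS.wordLengthLE_of_subgroup c₁
    have len : ∀ x ∈ L₀, ∀ x' ∈ L₀, WithinDist (α := SymLetter (X (Λ.τ e₀))) Subtype.val 1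
        (wordVal Subtype.val x) (wordVal Subtype.val x') → x'.length ≤ x.length + 1 := by
      rintro x - x' ⟨hx', -⟩ ⟨u, hu, e⟩
      have := isGeodesic_of_mem_shortlexWords hx' (x ++ u) (by simp [e])
      rw [List.length_append] at this
      omega
    have ft := (hK₁ z hz.1 y hy.1 c₁').map (higginsVal_vertexLetter 𝒢 (T := T) _)
    rw [map_one] at ft
    have hft := FellowTravel.append (q := n.word T) (q' := m.word T) (K' := K) hgen.symm ft
      (by rw [one_mul, one_mul, wordVal_vertex, wordVal_vertex]; exact c₄)
      (by simpa using len y hy z hz (WithinDist.symm SymLetter.symm c₁'))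
      (by simpa using len z hz y hy c₁')
    exact synchFellowTravel_iff.2 (by simpa using hft.map (f := MonoidHom.id _) hρ)

end IsShortlexGraph

end Automatic

theorem theorem4p3 {V E : Type*} [Finite V] [Finite E] (Λ : OppGraph V E) (hΛ : Λ.IsConnected)
    {Gv : V → Type*} [∀ v, Group (Gv v)] (𝒢 : GraphOfGroups Λ Gv)
    -- finite generating sets of the vertex groups and of the edge groups
    (X : ∀ v, Set (Gv v)) (hXfin : ∀ v, (X v).Finite)
    (hXgen : ∀ v, Subgroup.closure (X v) = ⊤)
    (Y : ∀ e, Set (Gv (Λ.τ e))) (hYfin : ∀ e, (Y e).Finite)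
    (hYgen : ∀ e, Subgroup.closure (Y e) = 𝒢.Ge e)
    (hYX : ∀ e, Y e ⊆ X (Λ.τ e))
    (hconcat : ∀ e, ConcatenatesUp (Y e) (X (Λ.τ e)) (hYX e))
    (hstable : ∀ e, IsStableIso (𝒢.φ e) (Y e) (Y (Λ.bar e)) 1)
    -- for every edge `e` an ordering of the alphabet of the group at its terminal vertex
    (lt : ∀ e, SymLetter (X (Λ.τ e)) → SymLetter (X (Λ.τ e)) → Prop)
    (hsl : ∀ e, IsShortlexAutomatic (X (Λ.τ e)) (lt e))
    (hfirst : ∀ e, ∀ a b : SymLetter (X (Λ.τ e)), (a.1 ∈ Y e ∨ a.1⁻¹ ∈ Y e) →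
      ¬ (b.1 ∈ Y e ∨ b.1⁻¹ ∈ Y e) → lt e a b)
    (T : Set E) (hT : Λ.IsMaximalTree T) (e₀ : E) :
    IsStrongSynchCosetAutomatic (higginsVal 𝒢 X T) (𝒢.edgeSubgroup T e₀)
      (higginsCosetLanguage 𝒢 X
        (fun e => cosetShortlex (Subtype.val) (lt e) (𝒢.Ge e)) e₀ T) ∧
    (∀ w ∈ higginsCosetLanguage 𝒢 X
        (fun e => cosetShortlex (Subtype.val) (lt e) (𝒢.Ge e)) e₀ T,
      IsCosetGeodesic (higginsVal 𝒢 X T) (𝒢.edgeSubgroup T e₀) w) ∧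
    IsAutomaticGroup (𝒢.Pi1 T) := by
  
  have hS : IsShortlexGraph 𝒢 X Y lt :=
    ⟨fun e => ⟨hYX e, hconcat e, hsl e, hfirst e⟩, hYgen, hstable⟩
  exact ⟨hS.isStrongSynchCosetAutomatic hXfin hXgen hT (hYfin e₀),
    fun w hw => hS.isCosetGeodesic_of_mem hT hw, hS.isAutomaticGroup hXfin hXgen hT e₀⟩
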